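/- **Setting.** Let $d>2$ be an integer and $\beta>0$. Let $D\subset\mathbb R^d$ be open, bounded and star-shaped with respect to the origin, let $\Phi=\{z_i\}$ be a homogeneous Poisson point process on $\mathbb R^d$ of intensity $\lambda>0$, defined on a probability space $(\Omega,\mathcal F,\mathbb P)$, and let the radii $\rho_i\ge 0$, $z_i\in\Phi$, be i.i.d. random variables, independent of $\Phi$, with $\langle\rho^{\,d-2+\beta}\rangle<\infty$. For $\varepsilon>0$ put $\Phi^\varepsilon(D)=\Phi\cap\frac1\varepsilon D$; for $\eta>0$ let $\Phi_{\eta}=\{x\in\Phi:\ |x-y|\ge\eta\ \text{for all } y\in\Phi,\ y\ne x\}$ and $\Phi^\varepsilon_\eta(D)=\Phi_\eta\cap\frac1\varepsilon D$. For $S\subset\Phi^\varepsilon(D)$ write $H^\varepsilon(S)=\bigcup_{z_i\in S}B_{\varepsilon^{d/(d-2)}\rho_i}(\varepsilon z_i)$ (open balls), and $H^\varepsilon=H^\varepsilon(\Phi^\varepsilon(D))$. **Lemma.** There are $\delta>0$ and an integer $k_{max}>0$, depending only on $d$ and $\beta$, such that for every $\theta>1$ there is $\Lambda>0$, depending only on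 $d$, $\beta$ and $\theta$, with the following property. In every setting as above, for $\mathbb P$-almost every $\omega$ there is $\varepsilon_0>0$ such that for all $0<\varepsilon\le\varepsilon_0$ one can choose * a set $n^\varepsilon\subset\Phi^\varepsilon(D)$ of good centres, with the set $\mathcal I^\varepsilon=\Phi^\varepsilon(D)\setminus n^\varepsilon$ of bad centres, and $H_g^\varepsilon=H^\varepsilon(n^\varepsilon)$, $H_b^\varepsilon=H^\varepsilon(\mathcal I^\varepsilon)$; * a subset $J^\varepsilon\subset\mathcal I^\varepsilon$ and factors $\lambda_j^\varepsilon\in[1,\Lambda]$, $z_j\in J^\varepsilon$; * partitions $\mathcal I^\varepsilon=\bigcup_{k=-3}^{k_{max}}\mathcal I_k^\varepsilon$ and $J^\varepsilon=\bigcup_{k=-3}^{k_{max}}J_k^\varepsilon$ with $J_k^\varepsilon\subset\mathcal I_k^\varepsilon$ for all $k$, so that the following holds. (i) (Covering) For all $0<\varepsilon\le\varepsilon_0$, $$H_b^\varepsilon\subset\bigcup_{z_j\in J^\varepsilon}B_{\lambda_j^\varepsilon\varepsilon^{d/(d-2)}\rho_j}(\varepsilon z_j),\qquad \lambda_j^\varepsilon\varepsilon^{\frac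 d{d-2}}\rho_j\le\Lambda\varepsilon^{2d\delta}\ \text{ for all } z_j\in J^\varepsilon,$$ and for every $k=-3,\dots,k_{max}$ $$H^\varepsilon(\mathcal I_k^\varepsilon)\subset\bigcup_{z_j\in J_k^\varepsilon}B_{\lambda_j^\varepsilon\varepsilon^{d/(d-2)}\rho_j}(\varepsilon z_j).$$ (ii) For all $0<\varepsilon\le\varepsilon_0$, all $k=-3,\dots,k_{max}$ and all $z_i\neq z_j$ in $J_k^\varepsilon$, $$B_{\theta^2\lambda_i^\varepsilon\varepsilon^{d/(d-2)}\rho_i}(\varepsilon z_i)\cap B_{\theta^2\lambda_j^\varepsilon\varepsilon^{d/(d-2)}\rho_j}(\varepsilon z_j)=\emptyset.$$ (iii) For all $0<\varepsilon\le\varepsilon_0$, all $k=-3,\dots,k_{max}$, all $z_i\in\mathcal I_k^\varepsilon$ and all $z_j\in\bigcup_{l=-3}^{k-1}J_l^\varepsilon$, $$B_{\varepsilon^{d/(d-2)}\rho_i}(\varepsilon z_i)\cap B_{\theta\lambda_j^\varepsilon\varepsilon^{d/(d-2)}\rho_j}(\varepsilon z_j)=\emptyset.$$ (iv) Put $D_b^\varepsilon=\bigcup_{z_j\in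 J^\varepsilon}B_{\theta\lambda_j^\varepsilon\varepsilon^{d/(d-2)}\rho_j}(\varepsilon z_j)$. For all $0<\varepsilon\le\varepsilon_0$, $H^\varepsilon$ is the disjoint union of $H_g^\varepsilon$ and $H_b^\varepsilon$, $H_b^\varepsilon\subset D_b^\varepsilon$, and $\operatorname{dist}(H_g^\varepsilon,D_b^\varepsilon)>\varepsilon^{1+\delta}$ (the distance to an empty set being $+\infty$); the balls $B_{\varepsilon^{d/(d-2)}\rho_i}(\varepsilon z_i)$, $z_i\in n^\varepsilon$, are pairwise disjoint, $\varepsilon|z_i-z_j|\ge 2\varepsilon^{1+\delta/2}$ for all $z_i\ne z_j$ in $n^\varepsilon$, and $\varepsilon^{d/(d-2)}\rho_i\le\varepsilon^{1+2\delta}$ for all $z_i\in n^\varepsilon$. Moreover, as $\varepsilon\downarrow0$, $|D_b^\varepsilon|\to0$, $\varepsilon^d\,\#n^\varepsilon\to\lambda|D|$ and, for every $\eta>0$, $$\varepsilon^d\,\#\{z_i\in\Phi^\varepsilon_{2\eta}(D):\ \operatorname{dist}(\varepsilon z_i,D_b^\varepsilon)\le\eta\varepsilon\}\to0 .$$ 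-/

import Mathlib

open MeasureTheory ProbabilityTheory Filter Topology Set
open scoped NNReal ENNReal Pointwise

noncomputable section

namespace RandomHoles

/-- Euclidean space `ℝ^d`. -/
abbrev E (d : ℕ) : Type := EuclideanSpace ℝ (Fin d)

/-- The number of indices `i` with `z i ∈ A`, i.e. the number `N(A)` of points of the point
configuration enumerated by `z` that lie in `A` (it may be infinite). -/
def count {d : ℕ} (z : ℕ → E d) (A : Set (E d)) : ℕ∞ := {i | z i ∈ A}.encard

/-- `(z, ρ)` is a marked point process on `ℝ^d`: the centres `z 0, z 1, …` enumerate without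
repetition a homogeneous Poisson point process `Φ` of intensity `lam`, and the mark (radius)
`ρ i ≥ 0` of the point `z i` is such that the marks are i.i.d. and independent of the centres. -/
structure IsMarkedPoisson {Ω : Type*} [MeasurableSpace Ω] (P : Measure Ω) {d : ℕ} (lam : ℝ≥0)
    (z : ℕ → Ω → E d) (ρ : ℕ → Ω → ℝ) : Prop where
  measurable_centre : ∀ i, Measurable (z i)
  measurable_mark : ∀ i, Measurable (ρ i)
  simple : ∀ᵐ ω ∂P, Function.Injective (fun i => z i ω)
  /-- `N(A)` is Poisson distributed with parameter `lam * |A|` for bounded Borel sets `A`. -/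
  count_law : ∀ A : Set (E d), MeasurableSet A → Bornology.IsBounded A →
    HasLaw (fun ω => count (fun i => z i ω) A)
      ((poissonMeasure (lam * (volume A).toNNReal)).map (Nat.cast : ℕ → ℕ∞)) P
  /-- The numbers of points in finitely many disjoint bounded Borel sets are independent. -/
  count_indep : ∀ (m : ℕ) (A : Fin m → Set (E d)), (∀ j, MeasurableSet (A j)) →
    (∀ j, Bornology.IsBounded (A j)) → Pairwise (fun j k => Disjoint (A j) (A k)) →
    iIndepFun (fun j ω => count (fun i => z i ω) (A j)) P
  mark_nonneg : ∀ i, ∀ᵐ ω ∂P, 0 ≤ ρ i ω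
  mark_indep : iIndepFun ρ P
  mark_identDistrib : ∀ i, IdentDistrib (ρ i) (ρ 0) P P
  centre_indep_mark : IndepFun (fun ω i => z i ω) (fun ω i => ρ i ω) P

/-! In the following, `x i` and `r i` are the `i`-th centre and radius of one realisation, and sets
of points of the configuration are given by their sets of indices. -/

/-- The points of the configuration lying in `(1/ε) D`, i.e. `Φ^ε(D)`. -/
def centres {d : ℕ} (D : Set (E d)) (x : ℕ → E d) (ε : ℝ) : Set ℕ := {i | x i ∈ ε⁻¹ • D}

/-- The thinned configuration: points at distance at least `η` from all the other points. -/
def thinned {d : ℕ} (x : ℕ → E d) (η : ℝ) : Set ℕ := {i | ∀ j, x j ≠ x i → η ≤ dist (x i) (x j)}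

/-- The rescaled radius `ε^{d/(d-2)} r`. -/
def scaledRadius (d : ℕ) (ε r : ℝ) : ℝ := ε ^ ((d : ℝ) / ((d : ℝ) - 2)) * r

/-- The `i`-th hole dilated by `a`: the ball of centre `ε x_i` and radius `a ε^{d/(d-2)} r_i`. -/
def hole {d : ℕ} (x : ℕ → E d) (r : ℕ → ℝ) (ε a : ℝ) (i : ℕ) : Set (E d) :=
  Metric.ball (ε • x i) (a * scaledRadius d ε (r i))

/-- The union of the (undilated) holes with index in `S`. -/
def holes {d : ℕ} (x : ℕ → E d) (r : ℕ → ℝ) (ε : ℝ) (S : Set ℕ) : Set (E d) :=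
  ⋃ i ∈ S, hole x r ε 1 i

/-- The distance between two sets; it is infinite if one of them is empty. -/
def setDist {d : ℕ} (A B : Set (E d)) : ℝ≥0∞ := ⨅ a ∈ A, Metric.infEDist a B

/-- The indices of the bad centres, `Φ^ε(D) \ n^ε`. -/
def bad {d : ℕ} (D : Set (E d)) (x : ℕ → E d) (n : ℝ → Set ℕ) (ε : ℝ) : Set ℕ :=
  centres D x ε \ n ε

/-- The splitting of the holes into good holes (with centres `n ε`) and bad holes, together with a
neighbourhood `Db ε` of the bad holes. The first fields hold for all `0 < ε ≤ ε₀`, the other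
ones are limits as `ε ↓ 0`. -/
structure IsSplitting {d : ℕ} (lam : ℝ≥0) (δ : ℝ) (D : Set (E d)) (x : ℕ → E d) (r : ℕ → ℝ)
    (ε₀ : ℝ) (n : ℝ → Set ℕ) (Db : ℝ → Set (E d)) : Prop where
  good_subset : ∀ ε ∈ Ioc 0 ε₀, n ε ⊆ centres D x ε
  /-- `H^ε` is partitioned into the good and the bad holes. -/
  union_eq : ∀ ε ∈ Ioc 0 ε₀,
    holes x r ε (centres D x ε) = holes x r ε (n ε) ∪ holes x r ε (bad D x n ε)
  disjoint_good_bad : ∀ ε ∈ Ioc 0 ε₀, Disjoint (holes x r ε (n ε)) (holes x r ε (bad D x n ε))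
  bad_subset : ∀ ε ∈ Ioc 0 ε₀, holes x r ε (bad D x n ε) ⊆ Db ε
  safety_layer : ∀ ε ∈ Ioc 0 ε₀, ENNReal.ofReal (ε ^ (1 + δ)) < setDist (holes x r ε (n ε)) (Db ε)
  good_disjoint : ∀ ε ∈ Ioc 0 ε₀, (n ε).PairwiseDisjoint (hole x r ε 1)
  good_separated : ∀ ε ∈ Ioc 0 ε₀, ∀ i ∈ n ε, ∀ j ∈ n ε, i ≠ j →
    2 * ε ^ (1 + δ / 2) ≤ ε * dist (x i) (x j)
  good_radius : ∀ ε ∈ Ioc 0 ε₀, ∀ i ∈ n ε, scaledRadius d ε (r i) ≤ ε ^ (1 + 2 * δ)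
  volume_tendsto : Tendsto (fun ε => volume (Db ε)) (𝓝[>] 0) (𝓝 0)
  good_density : Tendsto (fun ε : ℝ => ENNReal.ofReal (ε ^ d) * ((n ε).encard : ℝ≥0∞)) (𝓝[>] 0)
    (𝓝 (lam * volume D))
  few_near_bad : ∀ η : ℝ, 0 < η →
    Tendsto (fun ε : ℝ => ENNReal.ofReal (ε ^ d) *
      (({i ∈ thinned x (2 * η) ∩ centres D x ε |
        Metric.infEDist (ε • x i) (Db ε) ≤ ENNReal.ofReal (η * ε)}.encard : ℕ∞) : ℝ≥0∞))
      (𝓝[>] 0) (𝓝 0)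

/-- The covering of the bad holes, at a fixed scale `ε`: `I` is the set of bad centres, partitioned
into the families `If k`, `-3 ≤ k ≤ kmax`; `J` is the set of the centres of the covering balls,
partitioned into the families `Jf k`; `fac j` is the dilation factor of the ball with centre
`j`. -/
structure IsCovering {d : ℕ} (δ : ℝ) (kmax : ℕ) (θ Λ : ℝ) (x : ℕ → E d) (r : ℕ → ℝ) (ε : ℝ)
    (I J : Set ℕ) (If Jf : ℤ → Set ℕ) (fac : ℕ → ℝ) : Prop where
  subset : J ⊆ I
  factor : ∀ j ∈ J, fac j ∈ Icc 1 Λ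
  covers : holes x r ε I ⊆ ⋃ j ∈ J, hole x r ε (fac j) j
  radius_le : ∀ j ∈ J, fac j * scaledRadius d ε (r j) ≤ Λ * ε ^ (2 * (d : ℝ) * δ)
  iUnion_I : I = ⋃ k ∈ Icc (-3 : ℤ) kmax, If k
  disjoint_I : (Icc (-3 : ℤ) kmax).PairwiseDisjoint If
  iUnion_J : J = ⋃ k ∈ Icc (-3 : ℤ) kmax, Jf k
  disjoint_J : (Icc (-3 : ℤ) kmax).PairwiseDisjoint Jf
  family_subset : ∀ k ∈ Icc (-3 : ℤ) kmax, Jf k ⊆ If k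
  family_covers : ∀ k ∈ Icc (-3 : ℤ) kmax,
    holes x r ε (If k) ⊆ ⋃ j ∈ Jf k, hole x r ε (fac j) j
  family_disjoint : ∀ k ∈ Icc (-3 : ℤ) kmax, ∀ i ∈ Jf k, ∀ j ∈ Jf k, i ≠ j →
    hole x r ε (θ ^ 2 * fac i) i ∩ hole x r ε (θ ^ 2 * fac j) j = ∅
  earlier_disjoint : ∀ k ∈ Icc (-3 : ℤ) kmax, ∀ i ∈ If k, ∀ l ∈ Ico (-3 : ℤ) k, ∀ j ∈ Jf l,
    hole x r ε 1 i ∩ hole x r ε (θ * fac j) j = ∅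

end RandomHoles

end

/-!
Fix a small `δ = 1 / N` and sort the holes by their rescaled radius into `N + 2` classes, the
radii within a class differing by a factor of at most `ε ^ (-δ)`, except for the lowest class, which
consists of all radii up to `ε ^ (1 + 2 * δ)`. The proof has a probabilistic and a deterministic
part, which communicate through the predicate `IsTypical`.

*Probability.* The expected number of groups of `m` points of the Poisson process in a set `A`,
whose marks satisfy a condition of probability `q`, is at most `q * (lam * |A|) ^ m`
(`IsMarkedPoisson.lintegral_groups_le`). The moment of order `d - 2 + β` and Markov's inequality
show that the expected number of holes of a given class in a ball with radius of the order of the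
next larger class is at most a positive power of `ε` (`le_tailExponent`). Summing over a grid and
over dyadic `ε`, Borel–Cantelli yields (`IsMarkedPoisson.ae_tendsto_grouped`) that almost surely,
for small `ε`, at most `M` holes of the same class are that close to each other, that the proportion
of points close to another point or to a hole of a higher class vanishes, and that the
contribution of each class to the volume vanishes. The density of the points comes from Chebyshev's
inequality on integer dilates of `D`, and monotonicity of the dilates of a star-shaped set.

*Covering.* For such configurations the covering is constructed by induction on the number of
classes (`exists_isLayered`). The constants are chosen from the small to the large classes and the
families from the large to the small ones: once the dilation factors of the lower classes are known
to be at most `Λ`, the family of the highest class receives all balls that are joined to a ball of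
this class by a chain of balls of lower classes with links dilated by `θ * Λ`. Such a chain is at
most as long as a multiple of the lower bound for the radii of the highest class
(`IsClassified.dist_le_of_chain`), so that the family is covered by dilating only the balls of
the highest class; merging those which come too close to each other involves at most `M` balls each
time and hence only bounded factors (`exists_separated_cover`). A ball outside of this family is not
linked to it, which is the disjointness from the later families.

*Splitting.* A centre is good if it is isolated and not near a hole of the higher classes, where
`near` takes the dilation factor `θ * Λ` into account. The good holes then keep away from the
dilated covering balls, which are all centred at bad points, and the counting statements follow from
the vanishing proportion of points that violate one of these conditions.
-/

noncomputable section

namespace RandomHoles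

/-! ### Covering finitely many balls by well separated dilated balls -/

section Covering

variable {X : Type*} [PseudoMetricSpace X]

/-- A stage of the merging of the balls with index in `T`, dilated by `C`: the balls with index in
`J ⊆ T`, dilated by `f`, contain all of them, the ball `i` lying in the ball `π i`, and the
dilation factor of a ball is controlled by the number of balls assigned to it. -/
structure IsMerging (y : ℕ → X) (R : ℕ → ℝ) (T : Finset ℕ) (M : ℕ) (q C : ℝ) (J : Finset ℕ)
    (f : ℕ → ℝ) (π : ℕ → ℕ) : Prop where
  subset : J ⊆ T
  maps : ∀ i ∈ T, π i ∈ J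
  fixes : ∀ j ∈ J, π j = j
  covers : ∀ i ∈ T, dist (y i) (y (π i)) + C * R i ≤ f (π i) * R (π i)
  le_factor : ∀ j ∈ J, C ≤ f j
  factor_le : ∀ j ∈ J, f j ≤ C * q ^ ((T.filter (π · = j)).card - 1)
  card_le : ∀ j ∈ J, (T.filter (π · = j)).card ≤ M

/-- If two dilated balls touch, the larger one, `i`, can take over the balls assigned to the smaller
one, `j`, at the cost of a factor `2 * θ ^ 2 + 1`. -/
lemma IsMerging.merge {y : ℕ → X} {R : ℕ → ℝ} {T : Finset ℕ} {M : ℕ} {θ C s : ℝ}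
    {J : Finset ℕ} {f : ℕ → ℝ} {π : ℕ → ℕ} (hC : 1 ≤ C)
    (hR : ∀ i ∈ T, 0 ≤ R i ∧ R i ≤ s)
    (hcount : ∀ j ∈ T, ∀ t ⊆ T,
      (∀ i ∈ t, dist (y i) (y j) ≤ C * (2 * θ ^ 2 + 1) ^ (2 * M) * s) → t.card ≤ M)
    (h : IsMerging y R T M (2 * θ ^ 2 + 1) C J f π) {i j : ℕ} (hi : i ∈ J) (hj : j ∈ J)
    (hij : i ≠ j) (hle : f j * R j ≤ f i * R i)
    (hd : dist (y i) (y j) < θ ^ 2 * (f i * R i + f j * R j)) :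
    IsMerging y R T M (2 * θ ^ 2 + 1) C (J.erase j)
      (Function.update f i ((2 * θ ^ 2 + 1) * f i)) (fun a => if π a = j then i else π a) := by
  classical
  set q : ℝ := 2 * θ ^ 2 + 1 with hq
  have hq1 : 1 ≤ q := by nlinarith [sq_nonneg θ]
  have hfib_sub : T.filter (fun a => (if π a = j then i else π a) = i) ⊆
      T.filter (π · = i) ∪ T.filter (π · = j) := by
    intro a ha
    simp only [Finset.mem_filter, Finset.mem_union] at ha ⊢
    by_cases h1 : π a = j
    · exact Or.inr ⟨ha.1, h1⟩
    · rw [if_neg h1] at ha; exact Or.inl ha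
  have hfib_sup : T.filter (π · = i) ∪ T.filter (π · = j) ⊆
      T.filter (fun a => (if π a = j then i else π a) = i) := by
    intro a ha
    simp only [Finset.mem_filter, Finset.mem_union] at ha ⊢
    rcases ha with ⟨h1, h2⟩ | ⟨h1, h2⟩
    · exact ⟨h1, by rw [if_neg (by rw [h2]; exact hij)]; exact h2⟩
    · exact ⟨h1, by rw [if_pos h2]⟩
  have hdisj : Disjoint (T.filter (π · = i)) (T.filter (π · = j)) := by
    rw [Finset.disjoint_filter]
    intro a _ h1 h2
    exact hij (h1.symm.trans h2)
  have hcard : (T.filter (fun a => (if π a = j then i else π a) = i)).card =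
      (T.filter (π · = i)).card + (T.filter (π · = j)).card := by
    rw [← Finset.card_union_of_disjoint hdisj]
    exact congrArg _ (Finset.Subset.antisymm hfib_sub hfib_sup)
  have hpos : ∀ k ∈ J, 1 ≤ (T.filter (π · = k)).card := fun k hk =>
    Finset.card_pos.mpr ⟨k, Finset.mem_filter.mpr ⟨h.subset hk, h.fixes k hk⟩⟩
  have hother : ∀ k ∈ J, k ≠ i → k ≠ j →
      T.filter (fun a => (if π a = j then i else π a) = k) = T.filter (π · = k) := by
    intro k _ hki hkj
    refine Finset.filter_congr fun a _ => ?_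
    by_cases h1 : π a = j
    · rw [if_pos h1]
      exact ⟨fun h2 => absurd h2.symm hki, fun h2 => absurd (h2.symm.trans h1) hkj⟩
    · rw [if_neg h1]
  have hRi := hR i (h.subset hi)
  have hRj := hR j (h.subset hj)
  have hfi : 0 ≤ f i := by linarith [h.le_factor i hi]
  have hfiRi : 0 ≤ f i * R i := mul_nonneg hfi hRi.1
  -- the larger of two touching balls swallows the smaller one when dilated by `2 θ ^ 2 + 1`
  have hcov : ∀ a ∈ T, dist (y a) (y (if π a = j then i else π a)) + C * R a ≤
      Function.update f i (q * f i) (if π a = j then i else π a) *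
        R (if π a = j then i else π a) := by
    intro a ha
    have h0 := h.covers a ha
    by_cases h1 : π a = j
    · rw [if_pos h1, Function.update_self]
      rw [h1] at h0
      have h2 := dist_triangle (y a) (y j) (y i)
      rw [dist_comm (y j)] at h2
      nlinarith [mul_le_mul_of_nonneg_left hle (sq_nonneg θ)]
    · rw [if_neg h1]
      by_cases h2 : π a = i
      · rw [h2] at h0 ⊢
        rw [Function.update_self]
        nlinarith
      · rw [Function.update_of_ne h2]; exact h0
  have hfac : q * f i ≤
      C * q ^ ((T.filter (π · = i)).card + (T.filter (π · = j)).card - 1) := by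
    have h1 := h.factor_le i hi
    calc q * f i ≤ q * (C * q ^ ((T.filter (π · = i)).card - 1)) := by gcongr
      _ = C * q ^ ((T.filter (π · = i)).card - 1 + 1) := by ring
      _ ≤ _ := by
        have := hpos i hi
        have := hpos j hj
        gcongr
        omega
  refine ⟨(Finset.erase_subset _ _).trans h.subset, ?_, ?_, hcov, ?_, ?_, ?_⟩
  · intro a ha
    by_cases h1 : π a = j
    · simp only [if_pos h1]; exact Finset.mem_erase.mpr ⟨hij, hi⟩
    · simp only [if_neg h1]; exact Finset.mem_erase.mpr ⟨h1, h.maps a ha⟩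
  · intro k hk
    rw [Finset.mem_erase] at hk
    simp only [h.fixes k hk.2, if_neg hk.1]
  · intro k hk
    rw [Finset.mem_erase] at hk
    by_cases h1 : k = i
    · subst h1
      rw [Function.update_self]
      nlinarith [h.le_factor k hi]
    · rw [Function.update_of_ne h1]; exact h.le_factor k hk.2
  · intro k hk
    rw [Finset.mem_erase] at hk
    by_cases h1 : k = i
    · subst h1
      rw [Function.update_self, hcard]
      exact hfac
    · rw [Function.update_of_ne h1, hother k hk.2 h1 hk.1]; exact h.factor_le k hk.2
  · intro k hk
    rw [Finset.mem_erase] at hk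
    by_cases h1 : k = i
    · subst h1
      refine hcount k (h.subset hi) _ (Finset.filter_subset _ _) fun a ha => ?_
      rw [Finset.mem_filter] at ha
      have h2 := hcov a ha.1
      rw [ha.2, Function.update_self] at h2
      have h3 : 0 ≤ C * R a := mul_nonneg (by linarith) (hR a ha.1).1
      have h4 : q * f k ≤ C * q ^ (2 * M) := by
        refine hfac.trans ?_
        have := h.card_le k hi
        have := h.card_le j hj
        gcongr
        omega
      calc dist (y a) (y k) ≤ q * f k * R k := by linarith
        _ ≤ C * q ^ (2 * M) * s := by
          apply mul_le_mul h4 hRi.2 hRi.1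
          positivity
    · rw [hother k hk.2 h1 hk.1]; exact h.card_le k hk.2

lemma IsMerging.exists_separated {y : ℕ → X} {R : ℕ → ℝ} {T : Finset ℕ} {M : ℕ} {θ C s : ℝ}
    (hC : 1 ≤ C) (hR : ∀ i ∈ T, 0 ≤ R i ∧ R i ≤ s)
    (hcount : ∀ j ∈ T, ∀ t ⊆ T,
      (∀ i ∈ t, dist (y i) (y j) ≤ C * (2 * θ ^ 2 + 1) ^ (2 * M) * s) → t.card ≤ M)
    (N : ℕ) : ∀ (J : Finset ℕ) (f : ℕ → ℝ) (π : ℕ → ℕ), J.card = N →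
    IsMerging y R T M (2 * θ ^ 2 + 1) C J f π →
    ∃ (J' : Finset ℕ) (f' : ℕ → ℝ) (π' : ℕ → ℕ),
      IsMerging y R T M (2 * θ ^ 2 + 1) C J' f' π' ∧
      ∀ i ∈ J', ∀ j ∈ J', i ≠ j → θ ^ 2 * (f' i * R i + f' j * R j) ≤ dist (y i) (y j) := by
  induction N with
  | zero =>
    intro J f π hJ h
    refine ⟨J, f, π, h, fun i hi => ?_⟩
    rw [Finset.card_eq_zero.mp hJ] at hi
    simp at hi
  | succ N ih =>
    intro J f π hJ h
    by_cases hsep : ∀ i ∈ J, ∀ j ∈ J, i ≠ j →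
        θ ^ 2 * (f i * R i + f j * R j) ≤ dist (y i) (y j)
    · exact ⟨J, f, π, h, hsep⟩
    push Not at hsep
    obtain ⟨i, hi, j, hj, hij, hd⟩ := hsep
    rcases le_total (f j * R j) (f i * R i) with hle | hle
    · refine ih _ _ _ ?_ (h.merge hC hR hcount hi hj hij hle hd)
      rw [Finset.card_erase_of_mem hj, hJ]; rfl
    · refine ih _ _ _ ?_ (h.merge hC hR hcount hj hi hij.symm hle ?_)
      · rw [Finset.card_erase_of_mem hi, hJ]; rfl
      · rw [dist_comm, add_comm (f j * R j)]; exact hd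

/-- Balls of radii at most `s`, of which at most `M` have their centres in any given ball of
radius of order `s`, can be covered by dilating some of them by a bounded factor in such a way that
even the `θ ^ 2`-dilates of the covering balls are disjoint. As long as two dilated balls touch, the
larger one replaces both; at most `M` balls are ever merged into one. -/
lemma exists_separated_cover {y : ℕ → X} {R : ℕ → ℝ} {T : Finset ℕ} {M : ℕ} {θ C s : ℝ}
    (hC : 1 ≤ C) (hs : 0 ≤ s) (hR : ∀ i ∈ T, 0 ≤ R i ∧ R i ≤ s)
    (hcount : ∀ j ∈ T, ∀ t ⊆ T,
      (∀ i ∈ t, dist (y i) (y j) ≤ C * (2 * θ ^ 2 + 1) ^ (2 * M) * s) → t.card ≤ M) :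
    ∃ J ⊆ T, ∃ f : ℕ → ℝ, (∀ j ∈ J, C ≤ f j ∧ f j ≤ C * (2 * θ ^ 2 + 1) ^ M) ∧
      (∀ i ∈ T, ∃ j ∈ J, dist (y i) (y j) + C * R i ≤ f j * R j) ∧
      ∀ i ∈ J, ∀ j ∈ J, i ≠ j → θ ^ 2 * (f i * R i + f j * R j) ≤ dist (y i) (y j) := by
  have h0 : IsMerging y R T M (2 * θ ^ 2 + 1) C T (fun _ => C) id := by
    have hfil : ∀ j ∈ T, T.filter (fun a => id a = j) = {j} := by
      intro j hj; ext a; simp only [id, Finset.mem_filter, Finset.mem_singleton]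
      exact ⟨fun h => h.2, fun h => ⟨h ▸ hj, h⟩⟩
    refine ⟨subset_rfl, fun i hi => hi, fun _ _ => rfl, fun i _ => by simp, fun _ _ => le_rfl,
      fun j hj => ?_, fun j hj => ?_⟩
    · rw [hfil j hj]; simp
    · rw [hfil j hj]
      refine hcount j hj {j} (by simpa using hj) fun i hi => ?_
      rw [Finset.mem_singleton.mp hi, dist_self]
      positivity
  obtain ⟨J, f, π, h, hsep⟩ := IsMerging.exists_separated hC hR hcount _ T _ _ rfl h0
  refine ⟨J, h.subset, f, fun j hj => ⟨h.le_factor j hj, (h.factor_le j hj).trans ?_⟩,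
    fun i hi => ⟨π i, h.maps i hi, h.covers i hi⟩, hsep⟩
  have := h.card_le j hj
  gcongr
  · nlinarith [sq_nonneg θ]
  · omega

/-! ### Chains of balls and the layered covering -/

/-- Two balls with index in `I`, of class less than `l`, are linked if they meet after dilation
by `A`. -/
def Link (y : ℕ → X) (R : ℕ → ℝ) (cl : ℕ → ℕ) (I : Set ℕ) (A : ℝ) (l a b : ℕ) : Prop :=
  a ∈ I ∧ b ∈ I ∧ cl a < l ∧ cl b < l ∧ dist (y a) (y b) ≤ A * (R a + R b)

/-- The bound for the diameter of a chain of linked balls of class less than `l`, in units of the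
largest radius of these classes. -/
def chainConst (A : ℝ) (M : ℕ) : ℕ → ℝ
  | 0 => 0
  | l + 1 => (M + 1) * (4 * A + chainConst A M l)

lemma chainConst_nonneg {A : ℝ} (hA : 0 ≤ A) (M l : ℕ) : 0 ≤ chainConst A M l := by
  induction l with
  | zero => exact le_rfl
  | succ l ih => unfold chainConst; positivity

/-- A family of balls of finitely many size classes: the balls of class `l` have radius at most
`s l`, and more than `s (l - 1)` unless `l = 0`; at most `M` balls of class `l` have their centres
in a given ball of radius `L * s l`. -/
structure IsClassified (y : ℕ → X) (R : ℕ → ℝ) (cl : ℕ → ℕ) (I : Set ℕ) (s : ℕ → ℝ) (L : ℝ)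
    (M : ℕ) : Prop where
  nonneg : ∀ i ∈ I, 0 ≤ R i
  le : ∀ i ∈ I, R i ≤ s (cl i)
  lt : ∀ i ∈ I, ∀ l, cl i = l + 1 → s l < R i
  mono : Monotone s
  pos : 0 < s 0
  count : ∀ l, ∀ c ∈ I, ∀ t : Finset ℕ, (∀ i ∈ t, i ∈ I ∧ cl i = l ∧
    dist (y i) (y c) ≤ L * s l) → t.card ≤ M

lemma IsClassified.s_pos {y : ℕ → X} {R : ℕ → ℝ} {cl : ℕ → ℕ} {I : Set ℕ} {s : ℕ → ℝ}
    {L : ℝ} {M : ℕ} (h : IsClassified y R cl I s L M) (l : ℕ) : 0 < s l :=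
  h.pos.trans_le (h.mono (Nat.zero_le l))

lemma IsClassified.anti {y : ℕ → X} {R : ℕ → ℝ} {cl : ℕ → ℕ} {I I' : Set ℕ} {s : ℕ → ℝ}
    {L L' : ℝ} {M : ℕ} (h : IsClassified y R cl I s L M) (hI : I' ⊆ I) (hL : L' ≤ L) :
    IsClassified y R cl I' s L' M where
  nonneg i hi := h.nonneg i (hI hi)
  le i hi := h.le i (hI hi)
  lt i hi := h.lt i (hI hi)
  mono := h.mono
  pos := h.pos
  count l c hc t ht := h.count l c (hI hc) t fun i hi => ⟨hI (ht i hi).1, (ht i hi).2.1,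
    (ht i hi).2.2.trans (mul_le_mul_of_nonneg_right hL (h.s_pos l).le)⟩

/-- A chain of linked balls of class less than `l` is not longer than a multiple of the largest
radius of these classes. Among `M + 1` concentric annuli around the start of the chain one contains
no centre of the highest class, so that a chain can cross it only along balls of lower
classes. -/
lemma IsClassified.dist_le_of_chain {y : ℕ → X} {R : ℕ → ℝ} {cl : ℕ → ℕ} {I : Set ℕ}
    {s : ℕ → ℝ} {L A : ℝ} {M : ℕ} (h : IsClassified y R cl I s L M) (hA : 0 ≤ A) (l : ℕ)
    (hL : ∀ k ≤ l, chainConst A M k ≤ L) :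
    ∀ a ∈ I, ∀ b, Relation.ReflTransGen (Link y R cl I A l) a b →
      dist (y b) (y a) ≤ chainConst A M l * s (l - 1) := by
  induction l with
  | zero =>
    intro a _ b hab
    rcases Relation.ReflTransGen.cases_tail hab with rfl | ⟨c, _, hc⟩
    · simp [chainConst]
    · exact absurd hc.2.2.1 (by simp)
  | succ l ih =>
    specialize ih fun k hk => hL k (by omega)
    intro a ha b hab
    have hsl := h.s_pos l
    have hD := chainConst_nonneg hA M l
    set w : ℝ := (4 * A + chainConst A M l) * s l with hw
    have hw0 : 0 ≤ w := by positivity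
    have hconst : chainConst A M (l + 1) * s l = (M + 1) * w := by
      rw [hw, chainConst]; ring
    have hLw : (M + 1) * w ≤ L * s l := by
      rw [← hconst]; exact mul_le_mul_of_nonneg_right (hL _ le_rfl) hsl.le
    obtain ⟨j, hjM, hj⟩ : ∃ j ≤ M, ∀ i ∈ I, cl i = l →
        ¬ (j * w < dist (y i) (y a) ∧ dist (y i) (y a) ≤ (j + 1) * w) := by
      by_contra! hcon
      choose! g hgI hgl hg using hcon
      have hinj : Set.InjOn g (Finset.range (M + 1) : Set ℕ) := by
        have key : ∀ p ≤ M, ∀ p' ≤ M, g p = g p' → p ≤ p' := by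
          intro p hp p' hp' hpp
          by_contra! hlt
          have h1 := (hg p hp).1
          have h2 := (hg p' hp').2
          rw [hpp] at h1
          have h3 : ((p' : ℝ) + 1) * w ≤ p * w := by
            apply mul_le_mul_of_nonneg_right _ hw0
            exact_mod_cast hlt
          linarith
        intro p hp p' hp' hpp
        simp only [Finset.coe_range, Set.mem_Iio] at hp hp'
        exact le_antisymm (key p (by omega) p' (by omega) hpp)
          (key p' (by omega) p (by omega) hpp.symm)
      have hcard := h.count l a ha ((Finset.range (M + 1)).image g) fun i hi => by
        obtain ⟨p, hp, rfl⟩ := Finset.mem_image.mp hi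
        have hpM : p ≤ M := by simpa [Nat.lt_succ_iff] using hp
        refine ⟨hgI p hpM, hgl p hpM, (hg p hpM).2.trans (le_trans ?_ hLw)⟩
        apply mul_le_mul_of_nonneg_right _ hw0
        exact_mod_cast Nat.succ_le_succ hpM
      rw [Finset.card_image_of_injOn hinj, Finset.card_range] at hcard
      omega
    have hstep : ∀ c d, Link y R cl I A (l + 1) c d →
        dist (y d) (y a) ≤ dist (y c) (y a) + 2 * A * s l := by
      rintro c d ⟨hc, hd, hcl, hdl, hcd⟩
      have h1 := (h.le c hc).trans (h.mono (Nat.lt_succ_iff.mp hcl))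
      have h2 := (h.le d hd).trans (h.mono (Nat.lt_succ_iff.mp hdl))
      have h3 := dist_triangle (y d) (y c) (y a)
      rw [dist_comm (y d) (y c)] at h3
      have h4 := mul_le_mul_of_nonneg_left (add_le_add h1 h2) hA
      linarith
    have hbound : ∀ u c, u ∈ I → dist (y u) (y a) ≤ j * w + 2 * A * s l →
        Relation.ReflTransGen (Link y R cl I A l) u c →
        dist (y c) (y a) ≤ j * w + 2 * A * s l + chainConst A M l * s l := by
      intro u c hu hua huc
      have h1 := ih u hu c huc
      have h2 := dist_triangle (y c) (y u) (y a)
      have h3 : chainConst A M l * s (l - 1) ≤ chainConst A M l * s l :=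
        mul_le_mul_of_nonneg_left (h.mono (Nat.sub_le _ _)) hD
      linarith
    have hjw : j * w + 4 * A * s l + chainConst A M l * s l = (j + 1) * w := by rw [hw]; ring
    have hAs : 0 ≤ A * s l := by positivity
    have claim : dist (y b) (y a) ≤ j * w ∨ ∃ u ∈ I, dist (y u) (y a) ≤ j * w + 2 * A * s l ∧
        Relation.ReflTransGen (Link y R cl I A l) u b := by
      induction hab with
      | refl => left; rw [dist_self]; positivity
      | @tail c d _ hcd ihc =>
        by_cases hda : dist (y d) (y a) ≤ j * w
        · exact Or.inl hda
        push Not at hda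
        have hd := hstep c d hcd
        obtain ⟨hcI, hdI, hcl, hdl, hle⟩ := hcd
        have hlow : ∀ e ∈ I, cl e < l + 1 → j * w < dist (y e) (y a) →
            dist (y e) (y a) ≤ (j + 1) * w → cl e < l := fun e he hel h1 h2 =>
          lt_of_le_of_ne (Nat.lt_succ_iff.mp hel) fun h3 => hj e he h3 ⟨h1, h2⟩
        right
        by_cases hca : dist (y c) (y a) ≤ j * w
        · exact ⟨d, hdI, by linarith, Relation.ReflTransGen.refl⟩
        push Not at hca
        rcases ihc with h1 | ⟨u, huI, hua, huc⟩
        · exact absurd h1 (not_le.mpr hca)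
        have h1 := hbound u c huI hua huc
        have hcl' := hlow c hcI hcl hca (by linarith)
        have hdl' := hlow d hdI hdl hda (by linarith)
        exact ⟨u, huI, hua, huc.tail ⟨hcI, hdI, hcl', hdl', hle⟩⟩
    have hfin : dist (y b) (y a) ≤ (j + 1) * w := by
      rcases claim with h1 | ⟨u, huI, hua, hub⟩
      · have : (0 : ℝ) ≤ 1 * w := by linarith
        linarith [add_mul (j : ℝ) 1 w]
      · linarith [hbound u b huI hua hub]
    rw [Nat.add_sub_cancel, hconst]
    refine hfin.trans (mul_le_mul_of_nonneg_right ?_ hw0)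
    exact_mod_cast Nat.succ_le_succ hjM

lemma chainConst_mono {A : ℝ} (hA : 0 ≤ A) (M : ℕ) : Monotone (chainConst A M) := by
  refine monotone_nat_of_le_succ fun l => ?_
  have h := chainConst_nonneg hA M l
  have hM : (0 : ℝ) ≤ M := M.cast_nonneg
  rw [chainConst]
  nlinarith [mul_nonneg hM h, mul_nonneg hM hA]

/-- The families `If 0, …, If K` partition `I`, and the balls with index in `If k` are covered by
the balls with index in `Jf k ⊆ If k`, dilated by `f`; within a family the `θ ^ 2`-dilates of the
covering balls are disjoint, and the `θ`-dilates of the covering balls of earlier families do not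
meet the balls of later families. All statements are made in terms of centres and radii. -/
structure IsLayered (y : ℕ → X) (R : ℕ → ℝ) (θ Λ : ℝ) (K : ℕ) (I : Set ℕ) (If Jf : ℕ → Set ℕ)
    (f : ℕ → ℝ) : Prop where
  mem_iff : ∀ i, i ∈ I ↔ ∃ k ≤ K, i ∈ If k
  eq_of_mem : ∀ k ≤ K, ∀ l ≤ K, ∀ i, i ∈ If k → i ∈ If l → k = l
  subset : ∀ k ≤ K, Jf k ⊆ If k
  one_le : ∀ k ≤ K, ∀ j ∈ Jf k, 1 ≤ f j
  le : ∀ k ≤ K, ∀ j ∈ Jf k, f j ≤ Λ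
  covers : ∀ k ≤ K, ∀ i ∈ If k, ∃ j ∈ Jf k, dist (y i) (y j) + R i ≤ f j * R j
  separated : ∀ k ≤ K, ∀ i ∈ Jf k, ∀ j ∈ Jf k, i ≠ j →
    θ ^ 2 * (f i * R i + f j * R j) ≤ dist (y i) (y j)
  earlier : ∀ k ≤ K, ∀ i ∈ If k, ∀ l < k, ∀ j ∈ Jf l, R i + θ * f j * R j ≤ dist (y i) (y j)

/-- With a single class, the only family consists of all balls. -/
lemma exists_isLayered_zero (M : ℕ) {θ : ℝ} {y : ℕ → X} {R : ℕ → ℝ} {cl : ℕ → ℕ} {I : Set ℕ}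
    {s : ℕ → ℝ} (hI : I.Finite) (hcl : ∀ i ∈ I, cl i ≤ 0)
    (h : IsClassified y R cl I s ((2 * θ ^ 2 + 1) ^ (2 * M)) M) :
    ∃ (If Jf : ℕ → Set ℕ) (f : ℕ → ℝ),
      IsLayered y R θ ((2 * θ ^ 2 + 1) ^ M) 0 I If Jf f := by
  have hmem : ∀ {i}, i ∈ hI.toFinset ↔ i ∈ I := hI.mem_toFinset
  obtain ⟨J, hJ, f, hf, hcov, hsep⟩ := exists_separated_cover (y := y) (R := R)
    (T := hI.toFinset) (M := M) (θ := θ) (C := 1) (s := s 0) le_rfl h.pos.le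
    (fun i hi => ⟨h.nonneg i (hmem.1 hi), (h.le i (hmem.1 hi)).trans
      (h.mono (hcl i (hmem.1 hi)))⟩)
    (fun j hj t ht hd => h.count 0 j (hmem.1 hj) t fun i hi =>
      ⟨hmem.1 (ht hi), Nat.le_zero.mp (hcl i (hmem.1 (ht hi))), by simpa using hd i hi⟩)
  refine ⟨fun _ => I, fun _ => J, f, fun i => ⟨fun hi => ⟨0, le_rfl, hi⟩, fun ⟨_, _, hi⟩ => hi⟩,
    fun k hk l hl _ _ _ => by omega, fun _ _ j hj => hmem.1 (hJ hj), fun _ _ j hj => (hf j hj).1,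
    fun _ _ j hj => by simpa using (hf j hj).2, fun _ _ i hi => ?_, fun _ _ => hsep,
    fun k hk i _ l hl => by omega⟩
  simpa using hcov i (hmem.2 hi)

/-- The inductive step of the layered covering: all the balls that are joined to a ball of the
highest class by a chain of balls of lower classes, where the links of the chain are as wide as
the dilated covering balls of these classes, are put into the last family. -/
lemma exists_isLayered_succ {M K : ℕ} {θ Λ L : ℝ} (hθ : 1 ≤ θ) (hΛ : 1 ≤ Λ)
    (ih : ∀ (y : ℕ → X) (R : ℕ → ℝ) (cl : ℕ → ℕ) (I : Set ℕ) (s : ℕ → ℝ), I.Finite →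
      (∀ i ∈ I, cl i ≤ K) → IsClassified y R cl I s L M →
      ∃ (If Jf : ℕ → Set ℕ) (f : ℕ → ℝ), IsLayered y R θ Λ K I If Jf f)
    {A C L' Λ' : ℝ} (hA : A = θ * Λ) (hC : C = chainConst A M (K + 1) + A + 2)
    (hL₁ : L ≤ L') (hL₂ : C * (2 * θ ^ 2 + 1) ^ (2 * M) ≤ L')
    (hL₃ : chainConst A M (K + 1) ≤ L') (hΛ₁ : Λ ≤ Λ') (hΛ₂ : C * (2 * θ ^ 2 + 1) ^ M ≤ Λ')
    {y : ℕ → X} {R : ℕ → ℝ} {cl : ℕ → ℕ} {I : Set ℕ} {s : ℕ → ℝ} (hI : I.Finite)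
    (hcl : ∀ i ∈ I, cl i ≤ K + 1) (h : IsClassified y R cl I s L' M) :
    ∃ (If Jf : ℕ → Set ℕ) (f : ℕ → ℝ), IsLayered y R θ Λ' (K + 1) I If Jf f := by
  classical
  have hA1 : 1 ≤ A := by rw [hA]; nlinarith
  have hA0 : 0 ≤ A := by linarith
  have hD := chainConst_nonneg hA0 M (K + 1)
  have hC1 : 1 ≤ C := by rw [hC]; linarith
  -- `T` is the highest class, `U` consists of the balls joined to it by chains; the last link
  -- touches the undilated ball `t`, as dilated balls of `T` may well meet balls of other families
  set T : Set ℕ := {i ∈ I | cl i = K + 1} with hT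
  set U : Set ℕ := {i ∈ I | cl i < K + 1 ∧ ∃ a ∈ I, ∃ t ∈ T, cl a < K + 1 ∧
    Relation.ReflTransGen (Link y R cl I A (K + 1)) i a ∧
    dist (y a) (y t) ≤ A * R a + R t} with hU
  have hTfin : T.Finite := hI.subset fun i hi => hi.1
  have hmem : ∀ {i}, i ∈ hTfin.toFinset ↔ i ∈ T := hTfin.mem_toFinset
  obtain ⟨If, Jf, f, hlay⟩ := ih y R cl (I \ (T ∪ U)) s (hI.subset sdiff_subset)
    (fun i hi => by
      have h1 := hcl i hi.1
      have h2 : cl i ≠ K + 1 := fun h2 => hi.2 (Or.inl ⟨hi.1, h2⟩)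
      omega)
    (h.anti sdiff_subset hL₁)
  obtain ⟨J, hJ, g, hg, hcov, hsep⟩ := exists_separated_cover (y := y) (R := R)
    (T := hTfin.toFinset) (M := M) (θ := θ) (C := C) (s := s (K + 1)) hC1 (h.s_pos _).le
    (fun i hi => ⟨h.nonneg i (hmem.1 hi).1,
      (h.le i (hmem.1 hi).1).trans (h.mono (hmem.1 hi).2.le)⟩)
    (fun j hj t ht hd => h.count (K + 1) j (hmem.1 hj).1 t fun i hi =>
      ⟨(hmem.1 (ht hi)).1, (hmem.1 (ht hi)).2, (hd i hi).trans
        (mul_le_mul_of_nonneg_right hL₂ (h.s_pos _).le)⟩)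
  have hJT : ∀ j ∈ J, j ∈ T := fun j hj => hmem.1 (hJ hj)
  have hIf : ∀ k ≤ K, ∀ i ∈ If k, i ∈ I \ (T ∪ U) := fun k hk i hi =>
    (hlay.mem_iff i).2 ⟨k, hk, hi⟩
  have hJf : ∀ k ≤ K, ∀ j ∈ Jf k, j ∉ J := fun k hk j hj hjJ =>
    (hIf k hk j (hlay.subset k hk hj)).2 (Or.inl (hJT j hjJ))
  -- the balls of the last family are close to balls of the highest class
  have hnear : ∀ i ∈ T ∪ U, ∃ t ∈ T, dist (y i) (y t) + R i ≤ C * R t := by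
    rintro i (hi | ⟨hiI, hil, a, haI, t, ht, hal, hia, hat⟩)
    · refine ⟨i, hi, ?_⟩
      rw [dist_self]
      nlinarith [h.nonneg i hi.1]
    · refine ⟨t, ht, ?_⟩
      have hlow : ∀ b ∈ I, cl b < K + 1 → R b ≤ R t := fun b hb hbl =>
        (h.le b hb).trans ((h.mono (Nat.lt_succ_iff.mp hbl)).trans (h.lt t ht.1 K ht.2).le)
      have h1 := h.dist_le_of_chain hA0 (K + 1)
        (fun k hk => (chainConst_mono hA0 M hk).trans hL₃) i hiI a hia
      rw [Nat.add_sub_cancel] at h1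
      have h2 := mul_le_mul_of_nonneg_left (h.lt t ht.1 K ht.2).le hD
      have h3 := dist_triangle (y i) (y a) (y t)
      rw [dist_comm (y i) (y a)] at h3
      have h4 := mul_le_mul_of_nonneg_left (hlow a haI hal) hA0
      have h5 := hlow i hiI hil
      rw [hC]
      linarith
  refine ⟨fun k => if k = K + 1 then T ∪ U else If k, fun k => if k = K + 1 then J else Jf k,
    fun i => if i ∈ J then g i else f i, ?_, ?_, ?_, ?_, ?_, ?_, ?_, ?_⟩
  · intro i
    constructor
    · intro hi
      by_cases hiT : i ∈ T ∪ U
      · exact ⟨K + 1, le_rfl, by simpa using hiT⟩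
      · obtain ⟨k, hk, hik⟩ := (hlay.mem_iff i).1 ⟨hi, hiT⟩
        exact ⟨k, by omega, by rw [if_neg (by omega)]; exact hik⟩
    · rintro ⟨k, hk, hik⟩
      by_cases hkK : k = K + 1
      · rw [if_pos hkK] at hik
        rcases hik with hik | hik
        · exact hik.1
        · exact hik.1
      · rw [if_neg hkK] at hik
        exact (hIf k (by omega) i hik).1
  · intro k hk l hl i hik hil
    by_cases hkK : k = K + 1 <;> by_cases hlK : l = K + 1
    · omega
    · rw [if_pos hkK] at hik; rw [if_neg hlK] at hil
      exact absurd hik (hIf l (by omega) i hil).2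
    · rw [if_neg hkK] at hik; rw [if_pos hlK] at hil
      exact absurd hil (hIf k (by omega) i hik).2
    · rw [if_neg hkK] at hik; rw [if_neg hlK] at hil
      exact hlay.eq_of_mem k (by omega) l (by omega) i hik hil
  · intro k hk
    by_cases hkK : k = K + 1
    · simp only [if_pos hkK]
      exact fun j hj => Or.inl (hJT j hj)
    · simp only [if_neg hkK]
      exact hlay.subset k (by omega)
  · intro k hk j hj
    by_cases hkK : k = K + 1
    · rw [if_pos hkK] at hj
      simp only [if_pos (Finset.mem_coe.1 hj)]
      exact hC1.trans (hg j hj).1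
    · rw [if_neg hkK] at hj
      simp only [if_neg (hJf k (by omega) j hj)]
      exact hlay.one_le k (by omega) j hj
  · intro k hk j hj
    by_cases hkK : k = K + 1
    · rw [if_pos hkK] at hj
      simp only [if_pos (Finset.mem_coe.1 hj)]
      exact (hg j hj).2.trans hΛ₂
    · rw [if_neg hkK] at hj
      simp only [if_neg (hJf k (by omega) j hj)]
      exact (hlay.le k (by omega) j hj).trans hΛ₁
  · intro k hk i hi
    by_cases hkK : k = K + 1
    · simp only [if_pos hkK] at hi ⊢
      obtain ⟨t, ht, hit⟩ := hnear i hi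
      obtain ⟨j, hj, htj⟩ := hcov t (hmem.2 ht)
      refine ⟨j, hj, ?_⟩
      simp only [if_pos hj]
      linarith [dist_triangle (y i) (y t) (y j)]
    · simp only [if_neg hkK] at hi ⊢
      obtain ⟨j, hj, hij⟩ := hlay.covers k (by omega) i hi
      refine ⟨j, hj, ?_⟩
      simp only [if_neg (hJf k (by omega) j hj)]
      exact hij
  · intro k hk i hi j hj hij
    by_cases hkK : k = K + 1
    · rw [if_pos hkK] at hi hj
      simp only [if_pos (Finset.mem_coe.1 hi), if_pos (Finset.mem_coe.1 hj)]
      exact hsep i hi j hj hij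
    · rw [if_neg hkK] at hi hj
      simp only [if_neg (hJf k (by omega) i hi), if_neg (hJf k (by omega) j hj)]
      exact hlay.separated k (by omega) i hi j hj hij
  · intro k hk i hi l hl j hj
    rw [if_neg (by omega)] at hj
    simp only [if_neg (hJf l (by omega) j hj)]
    by_cases hkK : k = K + 1
    · rw [if_pos hkK] at hi
      -- a ball `j` of a lower family whose dilate meets `i` would prolong the chain from `i`
      by_contra! hlt
      have hjR := hIf l (by omega) j (hlay.subset l (by omega) hj)
      have hjl : cl j < K + 1 := lt_of_le_of_ne (hcl j hjR.1) fun h1 =>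
        hjR.2 (Or.inl ⟨hjR.1, h1⟩)
      have hRj := h.nonneg j hjR.1
      have h1 : θ * f j * R j ≤ A * R j := by
        rw [hA]
        have := hlay.le l (by omega) j hj
        gcongr
      rw [dist_comm] at hlt
      rcases hi with hi | ⟨hiI, hil, a, haI, t, ht, hal, hia, hat⟩
      · exact hjR.2 (Or.inr ⟨hjR.1, hjl, j, hjR.1, i, hi, hjl, Relation.ReflTransGen.refl,
          by linarith⟩)
      · refine hjR.2 (Or.inr ⟨hjR.1, hjl, a, haI, t, ht, hal, hia.head
          ⟨hjR.1, hiI, hjl, hil, ?_⟩, hat⟩)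
        nlinarith [h.nonneg i hiI]
    · rw [if_neg hkK] at hi
      exact hlay.earlier k (by omega) i hi l hl j hj

/-- Balls of finitely many size classes, such that only boundedly many balls of each class are
close to each other, have a layered covering with bounded dilation factors. -/
theorem exists_isLayered (X : Type*) [PseudoMetricSpace X] (M : ℕ) {θ : ℝ} (hθ : 1 ≤ θ) (K : ℕ) :
    ∃ Λ L : ℝ, 1 ≤ Λ ∧
      ∀ (y : ℕ → X) (R : ℕ → ℝ) (cl : ℕ → ℕ) (I : Set ℕ) (s : ℕ → ℝ), I.Finite →
        (∀ i ∈ I, cl i ≤ K) → IsClassified y R cl I s L M →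
        ∃ (If Jf : ℕ → Set ℕ) (f : ℕ → ℝ), IsLayered y R θ Λ K I If Jf f := by
  induction K with
  | zero =>
    refine ⟨(2 * θ ^ 2 + 1) ^ M, (2 * θ ^ 2 + 1) ^ (2 * M), one_le_pow₀ (by nlinarith), ?_⟩
    intro y R cl I s hI hcl h
    exact exists_isLayered_zero M hI hcl h
  | succ K ih =>
    obtain ⟨Λ, L, hΛ, ih⟩ := ih
    set A := θ * Λ with hA
    set C := chainConst A M (K + 1) + A + 2 with hC
    refine ⟨max Λ (C * (2 * θ ^ 2 + 1) ^ M),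
      max L (max (C * (2 * θ ^ 2 + 1) ^ (2 * M)) (chainConst A M (K + 1))),
      hΛ.trans (le_max_left _ _), ?_⟩
    intro y R cl I s hI hcl h
    exact exists_isLayered_succ hθ hΛ ih hA hC (le_max_left _ _)
      ((le_max_left _ _).trans (le_max_right _ _)) ((le_max_right _ _).trans (le_max_right _ _))
      (le_max_left _ _) (le_max_right _ _) hI hcl h

end Covering

/-! ### Moments of the Poisson distribution -/

lemma lintegral_poissonMeasure (r : ℝ≥0) (f : ℕ → ℝ≥0∞) :
    ∫⁻ n, f n ∂(poissonMeasure r) =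
      ∑' n : ℕ, ENNReal.ofReal (Real.exp (-r) * r ^ n / n.factorial) * f n := by
  rw [poissonMeasure, lintegral_sum_measure]
  congr with n
  rw [lintegral_smul_measure, lintegral_dirac, smul_eq_mul]

lemma lintegral_choose_poissonMeasure (r : ℝ≥0) (m : ℕ) :
    ∫⁻ n, (n.choose m : ℝ≥0∞) ∂(poissonMeasure r) =
      ENNReal.ofReal ((r : ℝ) ^ m / m.factorial) := by
  have hone : ∑' n : ℕ, ENNReal.ofReal (Real.exp (-r) * r ^ n / n.factorial) = 1 := by
    have := lintegral_poissonMeasure r 1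
    simpa using this.symm
  rw [lintegral_poissonMeasure]
  have hsupp : Function.support (fun n : ℕ =>
      ENNReal.ofReal (Real.exp (-r) * r ^ n / n.factorial) * (n.choose m : ℝ≥0∞)) ⊆
      range (fun k : ℕ => k + m) := by
    intro n hn
    by_contra hcon
    refine hn ?_
    have : n < m := by
      by_contra! hle
      exact hcon ⟨n - m, Nat.sub_add_cancel hle⟩
    simp [Nat.choose_eq_zero_of_lt this]
  rw [← (add_left_injective m).tsum_eq hsupp]
  have hterm : ∀ k : ℕ, ENNReal.ofReal (Real.exp (-r) * r ^ (k + m) / (k + m).factorial) *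
      ((k + m).choose m : ℝ≥0∞) = ENNReal.ofReal ((r : ℝ) ^ m / m.factorial) *
        ENNReal.ofReal (Real.exp (-r) * r ^ k / k.factorial) := by
    intro k
    rw [← ENNReal.ofReal_natCast, ← ENNReal.ofReal_mul (by positivity),
      ← ENNReal.ofReal_mul (by positivity)]
    congr 1
    rw [add_comm k m, Nat.cast_add_choose, add_comm m k]
    have h1 : ((k + m).factorial : ℝ) ≠ 0 := by positivity
    field_simp
    ring
  simp_rw [hterm]
  rw [ENNReal.tsum_mul_left, hone, mul_one]

/-- The variance of a Poisson random variable is at most its parameter. -/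
lemma lintegral_sq_sub_poissonMeasure_le (r : ℝ≥0) :
    ∫⁻ n, ENNReal.ofReal (((n : ℝ) - r) ^ 2) ∂(poissonMeasure r) ≤ r := by
  have h1 : ∫⁻ n, (n : ℝ≥0∞) ∂(poissonMeasure r) = r := by
    have := lintegral_choose_poissonMeasure r 1
    simpa using this
  have h2 := lintegral_choose_poissonMeasure r 2
  have key : ∀ n : ℕ, ENNReal.ofReal (((n : ℝ) - r) ^ 2) + 2 * r * (n : ℝ≥0∞) =
      2 * (n.choose 2 : ℝ≥0∞) + n + (r : ℝ≥0∞) ^ 2 := by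
    intro n
    have e1 : (r : ℝ≥0∞) = ENNReal.ofReal r := by simp
    have e2 : (2 : ℝ≥0∞) = ENNReal.ofReal 2 := by simp
    rw [e1, e2, ← ENNReal.ofReal_natCast n, ← ENNReal.ofReal_natCast (n.choose 2),
      ← ENNReal.ofReal_pow r.coe_nonneg, ← ENNReal.ofReal_mul (by norm_num),
      ← ENNReal.ofReal_mul (by norm_num), ← ENNReal.ofReal_mul (by positivity),
      ← ENNReal.ofReal_add (by positivity) (by positivity),
      ← ENNReal.ofReal_add (by positivity) (by positivity),
      ← ENNReal.ofReal_add (by positivity) (by positivity)]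
    congr 1
    rw [Nat.cast_choose_two]
    ring
  have hint : ∫⁻ n, ENNReal.ofReal (((n : ℝ) - r) ^ 2) ∂(poissonMeasure r) +
      2 * (r : ℝ≥0∞) * r = 2 * (r : ℝ≥0∞) * r + r := by
    have h3 : ∫⁻ n, (ENNReal.ofReal (((n : ℝ) - r) ^ 2) + 2 * r * (n : ℝ≥0∞))
        ∂(poissonMeasure r) = ∫⁻ n, (2 * (n.choose 2 : ℝ≥0∞) + n + (r : ℝ≥0∞) ^ 2)
        ∂(poissonMeasure r) := lintegral_congr key
    rw [lintegral_add_right _ .of_discrete, lintegral_const_mul _ .of_discrete, h1,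
      lintegral_add_right _ .of_discrete, lintegral_add_right _ .of_discrete,
      lintegral_const_mul _ .of_discrete, h1, h2, lintegral_const, measure_univ, mul_one] at h3
    rw [h3]
    have e1 : 2 * ENNReal.ofReal ((r : ℝ) ^ 2 / (Nat.factorial 2 : ℕ)) = (r : ℝ≥0∞) ^ 2 := by
      have e2 : (2 : ℝ≥0∞) = ENNReal.ofReal 2 := by simp
      rw [e2, ← ENNReal.ofReal_mul (by norm_num), Nat.factorial_two, Nat.cast_ofNat,
        mul_div_cancel₀ _ (by norm_num : (2 : ℝ) ≠ 0), ENNReal.ofReal_pow r.coe_nonneg,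
        ENNReal.ofReal_coe_nnreal]
    rw [e1]
    ring
  have hfin : 2 * (r : ℝ≥0∞) * r ≠ ∞ := by finiteness
  rw [add_comm] at hint
  exact (ENNReal.add_right_inj hfin).1 hint |>.le

/-! ### Expected numbers of groups of points -/

lemma tsum_subsets_eq_choose {S : Set ℕ} (hS : S.Finite) (m : ℕ) [DecidablePred
    fun s : Finset ℕ => s.card = m ∧ ∀ i ∈ s, i ∈ S] :
    (∑' s : Finset ℕ, if s.card = m ∧ ∀ i ∈ s, i ∈ S then (1 : ℝ≥0∞) else 0) =
      (S.ncard.choose m : ℝ≥0∞) := by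
  classical
  have h : ∀ s : Finset ℕ, (s.card = m ∧ ∀ i ∈ s, i ∈ S) ↔
      s ∈ hS.toFinset.powersetCard m := by
    intro s
    rw [Finset.mem_powersetCard, and_comm]
    simp [Finset.subset_iff]
  rw [tsum_eq_sum (s := hS.toFinset.powersetCard m) fun s hs => if_neg fun h1 => hs ((h s).1 h1),
    Finset.sum_congr rfl fun s hs => if_pos ((h s).2 hs), Finset.sum_const,
    Finset.card_powersetCard, nsmul_eq_mul, mul_one, ← Set.ncard_eq_toFinset_card S hS]

section Groups

variable {Ω : Type*} [MeasurableSpace Ω] {P : Measure Ω} {d : ℕ} {lam : ℝ≥0}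
  {z : ℕ → Ω → E d} {ρ : ℕ → Ω → ℝ}

lemma IsMarkedPoisson.lintegral_count (h : IsMarkedPoisson P lam z ρ) {A : Set (E d)}
    (hA : MeasurableSet A) (hb : Bornology.IsBounded A) (f : ℕ∞ → ℝ≥0∞) :
    ∫⁻ ω, f (count (fun i => z i ω) A) ∂P =
      ∫⁻ n, f (n : ℕ) ∂(poissonMeasure (lam * (volume A).toNNReal)) := by
  rw [(h.count_law A hA hb).lintegral_comp Measurable.of_discrete.aemeasurable,
    lintegral_map .of_discrete .of_discrete]

lemma IsMarkedPoisson.ae_finite (h : IsMarkedPoisson P lam z ρ) {A : Set (E d)}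
    (hA : MeasurableSet A) (hb : Bornology.IsBounded A) :
    ∀ᵐ ω ∂P, {i | z i ω ∈ A}.Finite := by
  have h1 : ∀ᵐ n ∂((poissonMeasure (lam * (volume A).toNNReal)).map (Nat.cast : ℕ → ℕ∞)),
      n ≠ ⊤ := by
    rw [ae_map_iff .of_discrete .of_discrete]
    exact Eventually.of_forall fun n => ENat.natCast_ne_top n
  have h2 := ((h.count_law A hA hb).ae_iff (p := fun n => n ≠ ⊤) .of_discrete).2 h1
  filter_upwards [h2] with ω hω
  exact Set.encard_ne_top_iff.1 hω

open Classical in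
/-- The number of groups of `m` points in `A` such that the mark sequence lies in `B s`, where `s`
is the set of indices of the group. -/
def groups (x : ℕ → E d) (r : ℕ → ℝ) (A : Set (E d)) (m : ℕ) (B : Finset ℕ → Set (ℕ → ℝ)) :
    ℝ≥0∞ :=
  ∑' s : Finset ℕ, if s.card = m ∧ (∀ i ∈ s, x i ∈ A) ∧ r ∈ B s then 1 else 0

lemma IsMarkedPoisson.measurableSet_group (h : IsMarkedPoisson P lam z ρ) {A : Set (E d)}
    (hA : MeasurableSet A) (s : Finset ℕ) : MeasurableSet {ω | ∀ i ∈ s, z i ω ∈ A} := by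
  have : {ω | ∀ i ∈ s, z i ω ∈ A} = ⋂ i ∈ s, z i ⁻¹' A := by ext; simp
  rw [this]
  exact Finset.measurableSet_biInter s fun i _ => h.measurable_centre i hA

lemma IsMarkedPoisson.measurableSet_marks (h : IsMarkedPoisson P lam z ρ) {B : Set (ℕ → ℝ)}
    (hB : MeasurableSet B) : MeasurableSet {ω | (fun i => ρ i ω) ∈ B} :=
  (measurable_pi_lambda (fun ω i => ρ i ω) h.measurable_mark) hB

lemma IsMarkedPoisson.measurable_groups (h : IsMarkedPoisson P lam z ρ) {A : Set (E d)}
    (hA : MeasurableSet A) (m : ℕ) {B : Finset ℕ → Set (ℕ → ℝ)} (hB : ∀ s, MeasurableSet (B s)) :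
    Measurable (fun ω => groups (fun i => z i ω) (fun i => ρ i ω) A m B) := by
  classical
  refine Measurable.tsum fun s => ?_
  refine Measurable.ite ?_ measurable_const measurable_const
  exact (MeasurableSet.const _).inter
    ((h.measurableSet_group hA s).inter (h.measurableSet_marks (hB s)))

/-- The expected number of groups of `m` points of a Poisson point process in `A` whose marks
satisfy a condition of probability at most `q` is at most `q * (lam * |A|) ^ m`. -/
lemma IsMarkedPoisson.lintegral_groups_le [IsProbabilityMeasure P]
    (h : IsMarkedPoisson P lam z ρ) {A : Set (E d)}
    (hA : MeasurableSet A) (hb : Bornology.IsBounded A) (m : ℕ) {B : Finset ℕ → Set (ℕ → ℝ)}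
    (hB : ∀ s, MeasurableSet (B s)) {q : ℝ≥0∞}
    (hq : ∀ s, s.card = m → P {ω | (fun i => ρ i ω) ∈ B s} ≤ q) :
    ∫⁻ ω, groups (fun i => z i ω) (fun i => ρ i ω) A m B ∂P ≤ q * (lam * volume A) ^ m := by
  classical
  have hvol : volume A ≠ ∞ := hb.measure_lt_top.ne
  have hmeas : ∀ s : Finset ℕ, MeasurableSet {ω | s.card = m ∧ (∀ i ∈ s, z i ω ∈ A)} := fun s =>
    (MeasurableSet.const _).inter (h.measurableSet_group hA s)
  have hcount : ∑' s : Finset ℕ, P {ω | s.card = m ∧ (∀ i ∈ s, z i ω ∈ A)} ≤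
      (lam * volume A) ^ m := by
    calc ∑' s : Finset ℕ, P {ω | s.card = m ∧ (∀ i ∈ s, z i ω ∈ A)}
        = ∑' s : Finset ℕ, ∫⁻ ω, (if s.card = m ∧ (∀ i ∈ s, z i ω ∈ A) then 1 else 0) ∂P := by
          congr with s
          rw [← lintegral_indicator_one (hmeas s)]
          refine lintegral_congr fun ω => ?_
          simp [Set.indicator_apply]
      _ = ∫⁻ ω, ∑' s : Finset ℕ, (if s.card = m ∧ (∀ i ∈ s, z i ω ∈ A) then 1 else 0) ∂P := by
          rw [lintegral_tsum]
          intro s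
          exact (Measurable.ite (hmeas s) measurable_const measurable_const).aemeasurable
      _ = ∫⁻ ω, (((count (fun i => z i ω) A).toNat.choose m : ℕ) : ℝ≥0∞) ∂P := by
          refine lintegral_congr_ae ?_
          filter_upwards [h.ae_finite hA hb] with ω hω
          exact tsum_subsets_eq_choose hω m
      _ = ENNReal.ofReal (((lam * (volume A).toNNReal : ℝ≥0) : ℝ) ^ m / m.factorial) := by
          rw [h.lintegral_count hA hb (fun n => (n.toNat.choose m : ℕ)),
            ← lintegral_choose_poissonMeasure]
          simp
      _ ≤ ENNReal.ofReal (((lam * (volume A).toNNReal : ℝ≥0) : ℝ) ^ m) := by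
          refine ENNReal.ofReal_le_ofReal (div_le_self (by positivity) ?_)
          exact_mod_cast Nat.succ_le_of_lt m.factorial_pos
      _ = (lam * volume A) ^ m := by
          rw [ENNReal.ofReal_pow (by positivity), ENNReal.ofReal_coe_nnreal, ENNReal.coe_mul,
            ENNReal.coe_toNNReal hvol]
  calc ∫⁻ ω, groups (fun i => z i ω) (fun i => ρ i ω) A m B ∂P
      = ∑' s : Finset ℕ, ∫⁻ ω, (if s.card = m ∧ (∀ i ∈ s, z i ω ∈ A) ∧
          (fun i => ρ i ω) ∈ B s then 1 else 0) ∂P := by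
        unfold groups
        rw [lintegral_tsum]
        intro s
        refine (Measurable.ite ?_ measurable_const measurable_const).aemeasurable
        exact (MeasurableSet.const _).inter
          ((h.measurableSet_group hA s).inter (h.measurableSet_marks (hB s)))
    _ ≤ ∑' s : Finset ℕ, q * P {ω | s.card = m ∧ (∀ i ∈ s, z i ω ∈ A)} := by
        refine ENNReal.tsum_le_tsum fun s => ?_
        by_cases hs : s.card = m
        swap
        · simp [hs]
        have e1 : ∫⁻ ω, (if s.card = m ∧ (∀ i ∈ s, z i ω ∈ A) ∧
            (fun i => ρ i ω) ∈ B s then (1 : ℝ≥0∞) else 0) ∂P =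
            P ({ω | ∀ i ∈ s, z i ω ∈ A} ∩ {ω | (fun i => ρ i ω) ∈ B s}) := by
          rw [← lintegral_indicator_one
            ((h.measurableSet_group hA s).inter (h.measurableSet_marks (hB s)))]
          refine lintegral_congr fun ω => ?_
          simp [hs, Set.indicator_apply]
        have e2 := h.centre_indep_mark.measure_inter_preimage_eq_mul
          {x : ℕ → E d | ∀ i ∈ s, x i ∈ A} (B s) (by
            have : {x : ℕ → E d | ∀ i ∈ s, x i ∈ A} = ⋂ i ∈ s, (fun x => x i) ⁻¹' A := by
              ext; simp
            rw [this]
            exact Finset.measurableSet_biInter s fun i _ => measurable_pi_apply i hA) (hB s)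
        rw [e1, mul_comm]
        refine (le_of_eq e2).trans ?_
        simp only [hs, true_and]
        exact mul_le_mul_right (hq s hs) _
    _ ≤ q * (lam * volume A) ^ m := by
        rw [ENNReal.tsum_mul_left]
        exact mul_le_mul_right hcount _

lemma IsMarkedPoisson.measure_mark_lt (h : IsMarkedPoisson P lam z ρ) (i : ℕ) (t : ℝ) :
    P {ω | t < ρ i ω} = P {ω | t < ρ 0 ω} :=
  (h.mark_identDistrib i).measure_mem_eq (measurableSet_Ioi (a := t))

lemma IsMarkedPoisson.measure_forall_mark_lt (h : IsMarkedPoisson P lam z ρ) (t : ℝ)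
    (s : Finset ℕ) :
    P {ω | (fun i => ρ i ω) ∈ {r : ℕ → ℝ | ∀ i ∈ s, t < r i}} = P {ω | t < ρ 0 ω} ^ s.card := by
  have h1 := h.mark_indep.measure_inter_preimage_eq_mul s (sets := fun _ => Ioi t)
    (fun _ _ => measurableSet_Ioi)
  have h2 : {ω | (fun i => ρ i ω) ∈ {r : ℕ → ℝ | ∀ i ∈ s, t < r i}} =
      ⋂ i ∈ s, ρ i ⁻¹' Ioi t := by ext; simp
  have h3 : ∀ i ∈ s, P (ρ i ⁻¹' Ioi t) = P {ω | t < ρ 0 ω} := fun i _ => h.measure_mark_lt i t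
  rw [h2, h1, Finset.prod_congr rfl h3, Finset.prod_const]

lemma IsMarkedPoisson.measure_exists_mark_lt_le (h : IsMarkedPoisson P lam z ρ) (t : ℝ)
    (s : Finset ℕ) :
    P {ω | (fun i => ρ i ω) ∈ {r : ℕ → ℝ | ∃ i ∈ s, t < r i}} ≤
      s.card * P {ω | t < ρ 0 ω} := by
  have h2 : {ω | (fun i => ρ i ω) ∈ {r : ℕ → ℝ | ∃ i ∈ s, t < r i}} =
      ⋃ i ∈ s, ρ i ⁻¹' Ioi t := by ext; simp
  rw [h2]
  refine (measure_biUnion_finset_le s _).trans (le_of_eq ?_)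
  have h3 : ∀ i ∈ s, P (ρ i ⁻¹' Ioi t) = P {ω | t < ρ 0 ω} := fun i _ => h.measure_mark_lt i t
  rw [Finset.sum_congr rfl h3, Finset.sum_const, nsmul_eq_mul]

end Groups

/-! ### From dyadic scales to all scales -/

lemma rpow_le_of_dyadic {a ε q : ℝ} (hq : 0 < q) (h1 : q / 2 < ε) (h2 : ε ≤ q) :
    ε ^ a ≤ 2 ^ |a| * q ^ a := by
  have hε : 0 < ε := by linarith
  rcases le_total 0 a with ha | ha
  · calc ε ^ a ≤ q ^ a := Real.rpow_le_rpow hε.le h2 ha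
      _ ≤ 2 ^ |a| * q ^ a := by
        refine le_mul_of_one_le_left (by positivity) ?_
        exact Real.one_le_rpow (by norm_num) (abs_nonneg a)
  · calc ε ^ a ≤ (q / 2) ^ a := Real.rpow_le_rpow_of_nonpos (by positivity) h1.le ha
      _ = 2 ^ |a| * q ^ a := by
        rw [Real.div_rpow hq.le (by norm_num), abs_of_nonpos ha, Real.rpow_neg (by norm_num)]
        ring

/-- A function that is bounded by a null sequence on the dyadic intervals of `(0, 1]` tends to zero
at `0`. -/
lemma tendsto_of_dyadic {F : ℝ → ℝ≥0∞} {Y : ℕ → ℝ≥0∞} {C : ℝ≥0∞} (hC : C ≠ ∞)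
    (hY : Tendsto Y atTop (𝓝 0))
    (hF : ∀ n : ℕ, ∀ ε : ℝ, (1 / 2 : ℝ) ^ n / 2 < ε → ε ≤ (1 / 2 : ℝ) ^ n → F ε ≤ C * Y n) :
    Tendsto F (𝓝[>] 0) (𝓝 0) := by
  have hCY : Tendsto (fun n => C * Y n) atTop (𝓝 0) := by
    simpa using ENNReal.Tendsto.const_mul hY (Or.inr hC)
  rw [ENNReal.tendsto_nhds_zero] at hCY ⊢
  intro κ hκ
  obtain ⟨N, hN⟩ := eventually_atTop.1 (hCY κ hκ)
  have hpos : (0 : ℝ) < (1 / 2 : ℝ) ^ N := by positivity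
  filter_upwards [Ioc_mem_nhdsGT hpos] with ε hε
  obtain ⟨n, hn1, hn2⟩ := exists_nat_pow_near_of_lt_one hε.1
    (hε.2.trans (pow_le_one₀ (by norm_num) (by norm_num))) (by norm_num : (0 : ℝ) < 1 / 2)
    (by norm_num)
  have hNn : N ≤ n := by
    by_contra! hlt
    have : (1 / 2 : ℝ) ^ N ≤ (1 / 2 : ℝ) ^ (n + 1) :=
      pow_le_pow_of_le_one (by norm_num) (by norm_num) hlt
    linarith [hε.2]
  refine (hF n ε ?_ hn2).trans (hN n hNn)
  rw [pow_succ] at hn1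
  linarith

lemma ae_tendsto_zero_of_tsum_lintegral {Ω : Type*} [MeasurableSpace Ω] {P : Measure Ω}
    {Y : ℕ → Ω → ℝ≥0∞} (hY : ∀ n, AEMeasurable (Y n) P) (hsum : ∑' n, ∫⁻ ω, Y n ω ∂P ≠ ∞) :
    ∀ᵐ ω ∂P, Tendsto (fun n => Y n ω) atTop (𝓝 0) := by
  rw [← lintegral_tsum hY] at hsum
  filter_upwards [ae_lt_top' (AEMeasurable.tsum hY) hsum] with ω hω
  exact ENNReal.tendsto_atTop_zero_of_tsum_ne_top hω.ne

/-! ### Covering a large ball by small balls -/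

lemma norm_le_of_coord_le {d : ℕ} {x : E d} {r : ℝ} (h : ∀ i, |x i| ≤ r) :
    ‖x‖ ≤ d * |r| := by
  rw [EuclideanSpace.norm_eq]
  refine Real.sqrt_le_iff.2 ⟨by positivity, ?_⟩
  calc ∑ i, ‖x i‖ ^ 2 ≤ ∑ _i : Fin d, |r| ^ 2 := by
        refine Finset.sum_le_sum fun i _ => ?_
        rw [Real.norm_eq_abs]
        exact pow_le_pow_left₀ (abs_nonneg _) ((h i).trans (le_abs_self r)) 2
    _ = d * |r| ^ 2 := by simp
    _ ≤ (d * |r|) ^ 2 := by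
        rw [mul_pow]
        refine mul_le_mul_of_nonneg_right ?_ (by positivity)
        exact_mod_cast Nat.le_self_pow (by norm_num) d

/-- The points of a grid of width `r` form a net of a ball of radius `W`. -/
lemma exists_finset_grid (d : ℕ) {r W : ℝ} (hr : 0 < r) (hW : r ≤ W) :
    ∃ G : Finset (E d), (G.card : ℝ) ≤ (5 * W / r) ^ d ∧
      ∀ y : E d, ‖y‖ ≤ W → ∃ g ∈ G, dist y g ≤ d * r := by
  classical
  set K : ℕ := ⌈W / r⌉₊ with hK
  have hWr : 1 ≤ W / r := (one_le_div hr).2 hW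
  have hKle : (K : ℝ) ≤ W / r + 1 := (Nat.ceil_lt_add_one (by linarith)).le
  refine ⟨(Fintype.piFinset fun _ : Fin d => Finset.Icc (-(K : ℤ)) K).image
    fun k => WithLp.toLp 2 fun i => r * (k i : ℝ), ?_, ?_⟩
  · have h1 : (((Fintype.piFinset fun _ : Fin d => Finset.Icc (-(K : ℤ)) K).image
        fun k => (WithLp.toLp 2 fun i => r * (k i : ℝ) : E d)).card : ℝ) ≤
        ((2 * K + 1 : ℕ) : ℝ) ^ d := by
      refine (Nat.cast_le.2 Finset.card_image_le).trans ?_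
      rw [Fintype.card_piFinset]
      simp only [Int.card_Icc, Finset.prod_const, Finset.card_univ, Fintype.card_fin]
      rw [← Nat.cast_pow]
      have : ((K : ℤ) + 1 - -(K : ℤ)).toNat = 2 * K + 1 := by omega
      rw [this]
    refine h1.trans (pow_le_pow_left₀ (by positivity) ?_ d)
    push_cast
    rw [mul_div_assoc]
    linarith
  · intro y hy
    refine ⟨WithLp.toLp 2 fun i => r * (⌊y i / r⌋ : ℝ),
      Finset.mem_image.2 ⟨fun i => ⌊y i / r⌋, ?_, rfl⟩, ?_⟩
    · rw [Fintype.mem_piFinset]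
      intro i
      have h1 : |y i| ≤ W := by
        have := PiLp.norm_apply_le (p := 2) y i
        rw [Real.norm_eq_abs] at this
        exact this.trans hy
      have h2 : |y i / r| ≤ K := by
        rw [abs_div, abs_of_pos hr]
        exact (div_le_div_of_nonneg_right h1 hr.le).trans (Nat.le_ceil _)
      rw [abs_le] at h2
      rw [Finset.mem_Icc]
      constructor
      · rw [Int.le_floor]; push_cast; linarith
      · have h3 : ((⌊y i / r⌋ : ℤ) : ℝ) ≤ ((K : ℤ) : ℝ) := by
          push_cast
          exact (Int.floor_le (y i / r)).trans h2.2
        exact Int.cast_le.1 h3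
    · rw [dist_eq_norm]
      have h2 := norm_le_of_coord_le (x := y - WithLp.toLp 2 fun i => r * (⌊y i / r⌋ : ℝ))
        (r := r) fun i => by
          have h3 : (y - WithLp.toLp 2 fun i => r * (⌊y i / r⌋ : ℝ) : E d) i =
              r * Int.fract (y i / r) := by
            simp only [PiLp.sub_apply, Int.fract]
            field_simp
          rw [h3, abs_of_nonneg (mul_nonneg hr.le (Int.fract_nonneg _))]
          exact mul_le_of_le_one_right hr.le (Int.fract_lt_one _).le
      rwa [abs_of_pos hr] at h2

/-! ### Points belonging to small groups -/

/-- The indices of the points which belong to a group of `m` points with mark condition `B` that is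
contained in a ball of radius `ℓ`, the centre of which has norm at most `W`. -/
def grouped {d : ℕ} (x : ℕ → E d) (r : ℕ → ℝ) (W ℓ : ℝ) (m : ℕ)
    (B : Finset ℕ → Set (ℕ → ℝ)) : Set ℕ :=
  {i | ∃ s : Finset ℕ, i ∈ s ∧ s.card = m ∧ r ∈ B s ∧ ∃ y : E d, ‖y‖ ≤ W ∧
    ∀ j ∈ s, dist (x j) y ≤ ℓ}

/-- If each index in `S` belongs to a group in one of the sets `A g`, then `S` has at most `m` times
as many elements as there are such groups. -/
lemma encard_le_of_groups {d : ℕ} {x : ℕ → E d} {r : ℕ → ℝ} {m : ℕ}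
    {B : Finset ℕ → Set (ℕ → ℝ)} {S : Set ℕ} (G : Finset (E d)) (A : E d → Set (E d))
    (hS : ∀ i ∈ S, ∃ g ∈ G, ∃ s : Finset ℕ, i ∈ s ∧ s.card = m ∧ (∀ j ∈ s, x j ∈ A g) ∧
      r ∈ B s) :
    ((S.encard : ℕ∞) : ℝ≥0∞) ≤ m * ∑ g ∈ G, groups x r (A g) m B := by
  classical
  have hmeas : ∀ T : Set ℕ, ((T.encard : ℕ∞) : ℝ≥0∞) = Measure.count T := fun T =>
    (Measure.count_apply (MeasurableSet.of_discrete)).symm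
  have hsub : S ⊆ ⋃ g ∈ G, ⋃ s : Finset ℕ,
      if s.card = m ∧ (∀ j ∈ s, x j ∈ A g) ∧ r ∈ B s then (s : Set ℕ) else ∅ := by
    intro i hi
    obtain ⟨g, hg, s, his, hs⟩ := hS i hi
    simp only [mem_iUnion]
    exact ⟨g, hg, s, by rw [if_pos hs]; exact his⟩
  rw [hmeas, Finset.mul_sum]
  refine (measure_mono hsub).trans ((measure_biUnion_finset_le _ _).trans ?_)
  refine Finset.sum_le_sum fun g _ => (measure_iUnion_le _).trans ?_
  rw [groups, ← ENNReal.tsum_mul_left]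
  refine ENNReal.tsum_le_tsum fun s => ?_
  split_ifs with hs
  · rw [Measure.count_apply_finset, hs.1, mul_one]
  · simp

section Grouped

variable {Ω : Type*} [MeasurableSpace Ω] {P : Measure Ω} {d : ℕ} {lam : ℝ≥0}
  {z : ℕ → Ω → E d} {ρ : ℕ → Ω → ℝ}

lemma IsMarkedPoisson.lintegral_sum_groups_le [IsProbabilityMeasure P]
    (h : IsMarkedPoisson P lam z ρ) {m : ℕ} {B : Finset ℕ → Set (ℕ → ℝ)}
    (hB : ∀ s, MeasurableSet (B s)) {q r W : ℝ} (hr : 0 < r) (hq0 : 0 ≤ q)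
    (hq : ∀ s, s.card = m → P {ω | (fun i => ρ i ω) ∈ B s} ≤ ENNReal.ofReal q)
    {G : Finset (E d)} (hG : (G.card : ℝ) ≤ (5 * W / r) ^ d) :
    ∫⁻ ω, ∑ g ∈ G, groups (fun i => z i ω) (fun i => ρ i ω)
        (Metric.closedBall g ((d + 1) * r)) m B ∂P ≤
      ENNReal.ofReal ((5 * W / r) ^ d * (q * (lam * (((d + 1) * r) ^ d *
        (volume (Metric.ball (0 : E d) 1)).toReal)) ^ m)) := by
  have hv : volume (Metric.ball (0 : E d) 1) ≠ ∞ := measure_ball_lt_top.ne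
  rw [lintegral_finsetSum _ fun g _ => h.measurable_groups Metric.isClosed_closedBall.measurableSet
    m hB]
  have hg : ∀ g ∈ G, ∫⁻ ω, groups (fun i => z i ω) (fun i => ρ i ω)
      (Metric.closedBall g ((d + 1) * r)) m B ∂P ≤
      ENNReal.ofReal (q * (lam * (((d + 1) * r) ^ d *
        (volume (Metric.ball (0 : E d) 1)).toReal)) ^ m) := by
    intro g _
    refine (h.lintegral_groups_le Metric.isClosed_closedBall.measurableSet
      Metric.isBounded_closedBall m hB hq).trans (le_of_eq ?_)
    rw [Measure.addHaar_closedBall _ _ (by positivity), finrank_euclideanSpace_fin,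
      ENNReal.ofReal_mul hq0, ENNReal.ofReal_pow (by positivity) m,
      ENNReal.ofReal_mul lam.coe_nonneg, ENNReal.ofReal_mul (by positivity),
      ENNReal.ofReal_toReal hv, ENNReal.ofReal_coe_nnreal]
  refine (Finset.sum_le_sum hg).trans ?_
  rw [Finset.sum_const, nsmul_eq_mul, ← ENNReal.ofReal_natCast, ← ENNReal.ofReal_mul (by positivity)]
  refine ENNReal.ofReal_le_ofReal (mul_le_mul_of_nonneg_right hG (by positivity))

/-- If the expected number of groups of `m` points of the rescaled process in small balls, weighted
by `ε ^ e`, decays like a positive power of `ε`, then almost surely the weighted number of points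
belonging to such groups vanishes as `ε → 0`. The Borel–Cantelli lemma is used at the dyadic scales;
the other scales follow by monotonicity. -/
theorem IsMarkedPoisson.ae_tendsto_grouped [IsProbabilityMeasure P]
    (h : IsMarkedPoisson P lam z ρ) {W a e κ K : ℝ} (hW : 0 < W) (ha : -1 ≤ a) (hK : 0 ≤ K)
    {m : ℕ} {B : ℝ → Finset ℕ → Set (ℕ → ℝ)} (hB : ∀ ε s, MeasurableSet (B ε s))
    (hmono : ∀ ε ε' s, 0 < ε → ε ≤ ε' → B ε s ⊆ B ε' s)
    (hq : ∀ ε s, 0 < ε → s.card = m →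
      P {ω | (fun i => ρ i ω) ∈ B ε s} ≤ ENNReal.ofReal (K * ε ^ κ))
    (hexp : 0 < e - d - d * a + m * (d * a) + κ) :
    ∀ᵐ ω ∂P, Tendsto (fun ε : ℝ => ENNReal.ofReal (ε ^ e) *
      (((grouped (fun i => z i ω) (fun i => ρ i ω) (W / ε) (ε ^ a) m (B ε)).encard : ℕ∞) :
        ℝ≥0∞)) (𝓝[>] 0) (𝓝 0) := by
  set q : ℕ → ℝ := fun n => (1 / 2 : ℝ) ^ n with hqdef
  have hq0 : ∀ n, 0 < q n := fun n => by positivity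
  have hq1 : ∀ n, q n ≤ 1 := fun n => pow_le_one₀ (by norm_num) (by norm_num)
  -- between two dyadic scales `ε ^ a` changes by a factor of at most `c`, and `W / ε` by `2`
  set c : ℝ := 2 ^ |a| with hc
  have hc0 : 0 < c := by positivity
  set W' : ℝ := max (2 * W) c with hW'
  have hW'0 : 0 < W' := lt_of_lt_of_le hc0 (le_max_right _ _)
  have hrW : ∀ n, c * q n ^ a ≤ W' / q n := by
    intro n
    rw [div_eq_mul_inv, ← Real.rpow_neg_one]
    refine mul_le_mul (le_max_right _ _) ?_ (by have := hq0 n; positivity) hW'0.le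
    exact Real.rpow_le_rpow_of_exponent_ge (hq0 n) (hq1 n) ha
  have hr0 : ∀ n, 0 < c * q n ^ a := fun n => by have := hq0 n; positivity
  choose G hGcard hG using fun n => exists_finset_grid d (hr0 n) (hrW n)
  set v : ℝ := (volume (Metric.ball (0 : E d) 1)).toReal with hv
  set Y : ℕ → Ω → ℝ≥0∞ := fun n ω => ENNReal.ofReal (q n ^ e) *
    ∑ g ∈ G n, groups (fun i => z i ω) (fun i => ρ i ω)
        (Metric.closedBall g ((d + 1) * (c * q n ^ a))) m (B (q n)) with hY
  have hmeas0 : ∀ n, Measurable fun ω => ∑ g ∈ G n, groups (fun i => z i ω) (fun i => ρ i ω)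
        (Metric.closedBall g ((d + 1) * (c * q n ^ a))) m (B (q n)) := fun n =>
    Finset.measurable_sum _ fun g _ =>
      h.measurable_groups Metric.isClosed_closedBall.measurableSet m (hB _)
  set x : ℝ := e - d - d * a + m * (d * a) + κ with hx
  set C : ℝ := (5 * W' / c) ^ d * (K * (lam * (((d + 1) * c) ^ d * v)) ^ m) with hC
  have hint : ∀ n, ∫⁻ ω, Y n ω ∂P ≤ ENNReal.ofReal (C * ((1 / 2 : ℝ) ^ x) ^ n) := by
    intro n
    have hqn := hq0 n
    rw [hY]
    simp only
    rw [lintegral_const_mul _ (hmeas0 n)]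
    refine (mul_le_mul_right (h.lintegral_sum_groups_le (hB (q n)) (hr0 n)
      (mul_nonneg hK (Real.rpow_nonneg hqn.le κ)) (fun s hs => hq (q n) s hqn hs)
      (hGcard n)) _).trans (le_of_eq ?_)
    rw [← ENNReal.ofReal_mul (by positivity)]
    congr 1
    have e1 : ((1 / 2 : ℝ) ^ x) ^ n = q n ^ x := by
      rw [hqdef]
      simp only
      rw [← Real.rpow_natCast, ← Real.rpow_mul (by norm_num), mul_comm x,
        Real.rpow_mul (by norm_num), Real.rpow_natCast]
    have e2 : q n ^ x = q n ^ e * ((q n ^ d)⁻¹ * ((q n ^ a) ^ d)⁻¹ *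
        (((q n ^ a) ^ d) ^ m * q n ^ κ)) := by
      have h1 : q n ^ ((d : ℝ) * a) = (q n ^ a) ^ d := by
        rw [mul_comm, Real.rpow_mul hqn.le, Real.rpow_natCast]
      have h2 : q n ^ ((m : ℝ) * (d * a)) = ((q n ^ a) ^ d) ^ m := by
        rw [mul_comm, Real.rpow_mul hqn.le, Real.rpow_natCast, h1]
      rw [hx, Real.rpow_add hqn, Real.rpow_add hqn, Real.rpow_sub hqn, Real.rpow_sub hqn,
        Real.rpow_natCast, h1, h2]
      field_simp
    rw [e1, e2, hC]
    have e3 : q n ^ a ≠ 0 := by positivity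
    simp only [div_pow, mul_pow]
    field_simp
    rw [hv]
  have hsum : ∑' n, ∫⁻ ω, Y n ω ∂P ≠ ∞ := by
    refine ne_top_of_le_ne_top ?_ (ENNReal.tsum_le_tsum hint)
    refine Summable.tsum_ofReal_ne_top (Summable.mul_left C ?_)
    exact summable_geometric_of_lt_one (by positivity)
      (Real.rpow_lt_one (by norm_num) (by norm_num) hexp)
  filter_upwards [ae_tendsto_zero_of_tsum_lintegral
    (fun n => ((hmeas0 n).const_mul _).aemeasurable) hsum] with ω hω
  refine tendsto_of_dyadic (C := ENNReal.ofReal (2 ^ |e|) * m) (by finiteness) hω ?_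
  intro n ε h1 h2
  have hqn := hq0 n
  have hε : 0 < ε := lt_trans (by positivity) h1
  have hb1 : ENNReal.ofReal (ε ^ e) ≤ ENNReal.ofReal (2 ^ |e|) * ENNReal.ofReal (q n ^ e) := by
    rw [← ENNReal.ofReal_mul (by positivity)]
    exact ENNReal.ofReal_le_ofReal (rpow_le_of_dyadic hqn h1 h2)
  have hb2 := encard_le_of_groups (x := fun i => z i ω) (r := fun i => ρ i ω) (m := m)
    (B := B (q n)) (S := grouped (fun i => z i ω) (fun i => ρ i ω) (W / ε) (ε ^ a) m (B ε))
    (G n) (fun g => Metric.closedBall g ((d + 1) * (c * q n ^ a))) (by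
      rintro i ⟨s, his, hsm, hsB, y, hy, hys⟩
      have hyW : ‖y‖ ≤ W' / q n := by
        refine hy.trans ?_
        rw [div_le_div_iff₀ hε hqn]
        have h3 : W * q n ≤ W * (2 * ε) := by
          have h4 : q n ≤ 2 * ε := by
            have : q n / 2 < ε := h1
            linarith
          gcongr
        have h5 : 2 * W * ε ≤ W' * ε := by
          gcongr
          exact le_max_left _ _
        linarith
      obtain ⟨g, hg, hyg⟩ := hG n y hyW
      refine ⟨g, hg, s, his, hsm, fun j hj => ?_, hmono ε (q n) s hε h2 hsB⟩
      rw [Metric.mem_closedBall]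
      have h3 : ε ^ a ≤ c * q n ^ a := rpow_le_of_dyadic hqn h1 h2
      have h4 := dist_triangle (z j ω) y g
      have h5 := hys j hj
      linarith)
  calc _ ≤ (ENNReal.ofReal (2 ^ |e|) * ENNReal.ofReal (q n ^ e)) * (m * _) :=
        mul_le_mul' hb1 hb2
    _ = ENNReal.ofReal (2 ^ |e|) * m * Y n ω := by rw [hY]; ring

end Grouped

section AlmostSure

variable {Ω : Type*} [MeasurableSpace Ω] {P : Measure Ω} {d : ℕ} {lam : ℝ≥0}
  {z : ℕ → Ω → E d} {ρ : ℕ → Ω → ℝ}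

lemma coe_encard_mono {S T : Set ℕ} (h : S ⊆ T) :
    ((S.encard : ℕ∞) : ℝ≥0∞) ≤ ((T.encard : ℕ∞) : ℝ≥0∞) :=
  ENat.toENNReal_le.2 (encard_le_encard h)

lemma tendsto_encard_of_subset {a : ℝ → ℝ≥0∞} {S T : ℝ → Set ℕ}
    (hT : Tendsto (fun ε => a ε * (((T ε).encard : ℕ∞) : ℝ≥0∞)) (𝓝[>] 0) (𝓝 0))
    (h : ∀ᶠ ε in 𝓝[>] 0, S ε ⊆ T ε) :
    Tendsto (fun ε => a ε * (((S ε).encard : ℕ∞) : ℝ≥0∞)) (𝓝[>] 0) (𝓝 0) := by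
  refine tendsto_of_tendsto_of_tendsto_of_le_of_le' tendsto_const_nhds hT
    (Eventually.of_forall fun _ => zero_le) ?_
  filter_upwards [h] with ε hε
  exact mul_le_mul_right (coe_encard_mono hε) _

lemma measurableSet_forall_mark_lt (t : ℝ) (s : Finset ℕ) :
    MeasurableSet {r : ℕ → ℝ | ∀ i ∈ s, t < r i} := by
  have : {r : ℕ → ℝ | ∀ i ∈ s, t < r i} = ⋂ i ∈ s, (fun r => r i) ⁻¹' Ioi t := by ext; simp
  rw [this]
  exact Finset.measurableSet_biInter s fun i _ => measurable_pi_apply i measurableSet_Ioi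

lemma measurableSet_exists_mark_lt (t : ℝ) (s : Finset ℕ) :
    MeasurableSet {r : ℕ → ℝ | ∃ i ∈ s, t < r i} := by
  have : {r : ℕ → ℝ | ∃ i ∈ s, t < r i} = ⋃ i ∈ s, (fun r => r i) ⁻¹' Ioi t := by ext; simp
  rw [this]
  exact Finset.measurableSet_biUnion s fun i _ => measurable_pi_apply i measurableSet_Ioi

/-- The weighted number of points with a large mark vanishes. -/
lemma IsMarkedPoisson.ae_tendsto_large [IsProbabilityMeasure P] (h : IsMarkedPoisson P lam z ρ)
    {W e b K : ℝ} (hW : 0 < W) (hK : 0 ≤ K) {t : ℝ → ℝ}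
    (ht : ∀ ε ε', 0 < ε → ε ≤ ε' → t ε' ≤ t ε)
    (hp : ∀ ε, 0 < ε → P {ω | t ε < ρ 0 ω} ≤ ENNReal.ofReal (K * ε ^ b)) (hexp : d < e + b) :
    ∀ᵐ ω ∂P, Tendsto (fun ε : ℝ => ENNReal.ofReal (ε ^ e) *
      (({i | ‖z i ω‖ ≤ W / ε ∧ t ε < ρ i ω}.encard : ℕ∞) : ℝ≥0∞)) (𝓝[>] 0) (𝓝 0) := by
  have h1 := h.ae_tendsto_grouped (m := 1) (a := 0) (e := e) (κ := b) hW (by norm_num) hK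
    (B := fun ε s => {r | ∀ i ∈ s, t ε < r i}) (fun ε s => measurableSet_forall_mark_lt _ _)
    (fun ε ε' s hε hle r hr i hi => (ht ε ε' hε hle).trans_lt (hr i hi))
    (fun ε s hε hs => by
      rw [h.measure_forall_mark_lt, hs, pow_one]
      exact hp ε hε)
    (by simp; linarith)
  filter_upwards [h1] with ω hω
  refine tendsto_encard_of_subset hω (Eventually.of_forall fun ε i hi => ?_)
  exact ⟨{i}, by simp, by simp, by simpa using hi.2, z i ω, hi.1, by simp⟩

/-- The proportion of points that are close to another point with a large mark vanishes. -/
lemma IsMarkedPoisson.ae_tendsto_close [IsProbabilityMeasure P] (h : IsMarkedPoisson P lam z ρ)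
    {W a b K : ℝ} (hW : 0 < W) (ha : -1 ≤ a) (hK : 0 ≤ K) {t : ℝ → ℝ}
    (ht : ∀ ε ε', 0 < ε → ε ≤ ε' → t ε' ≤ t ε)
    (hp : ∀ ε, 0 < ε → P {ω | t ε < ρ 0 ω} ≤ ENNReal.ofReal (K * ε ^ b))
    (hexp : 0 < d * a + b) :
    ∀ᵐ ω ∂P, Tendsto (fun ε : ℝ => ENNReal.ofReal (ε ^ d) *
      (({i | ‖z i ω‖ ≤ W / ε ∧ ∃ j, j ≠ i ∧ dist (z i ω) (z j ω) ≤ ε ^ a ∧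
        t ε < ρ j ω}.encard : ℕ∞) : ℝ≥0∞)) (𝓝[>] 0) (𝓝 0) := by
  have h1 := h.ae_tendsto_grouped (m := 2) (a := a) (e := d) (κ := b) (K := 2 * K) hW ha
    (by positivity)
    (B := fun ε s => {r | ∃ i ∈ s, t ε < r i}) (fun ε s => measurableSet_exists_mark_lt _ _)
    (fun ε ε' s hε hle r ⟨i, hi, hr⟩ => ⟨i, hi, (ht ε ε' hε hle).trans_lt hr⟩)
    (fun ε s hε hs => by
      refine (h.measure_exists_mark_lt_le _ s).trans ?_
      rw [hs, mul_assoc, ENNReal.ofReal_mul (by norm_num)]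
      refine mul_le_mul' (by simp) (hp ε hε))
    (by push_cast; linarith)
  filter_upwards [h1] with ω hω
  simp only [Real.rpow_natCast] at hω
  refine tendsto_encard_of_subset hω ?_
  filter_upwards [self_mem_nhdsWithin] with ε hε i hi
  obtain ⟨hi, j, hji, hd, hj⟩ := hi
  refine ⟨{i, j}, by simp, Finset.card_pair hji.symm, ⟨j, by simp, hj⟩, z i ω, hi, ?_⟩
  intro k hk
  rw [Finset.mem_insert, Finset.mem_singleton] at hk
  rcases hk with rfl | rfl
  · rw [dist_self]
    exact Real.rpow_nonneg (le_of_lt hε) a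
  · rw [dist_comm]; exact hd

/-- Eventually there are no groups of `m` points with large marks that are close to each other. -/
lemma IsMarkedPoisson.ae_eventually_card_lt [IsProbabilityMeasure P]
    (h : IsMarkedPoisson P lam z ρ) {W a b K : ℝ} (hW : 0 < W) (ha : -1 ≤ a) (hK : 0 ≤ K)
    {t : ℝ → ℝ} (ht : ∀ ε ε', 0 < ε → ε ≤ ε' → t ε' ≤ t ε)
    (hp : ∀ ε, 0 < ε → P {ω | t ε < ρ 0 ω} ≤ ENNReal.ofReal (K * ε ^ b)) {m : ℕ} (hm : 0 < m)
    (hexp : d + d * a < m * (d * a + b)) :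
    ∀ᵐ ω ∂P, ∀ᶠ ε : ℝ in 𝓝[>] 0, ∀ c, ‖z c ω‖ ≤ W / ε → ∀ s : Finset ℕ,
      (∀ i ∈ s, dist (z i ω) (z c ω) ≤ ε ^ a ∧ t ε < ρ i ω) → s.card < m := by
  have h1 := h.ae_tendsto_grouped (m := m) (a := a) (e := 0) (κ := m * b) (K := K ^ m) hW ha
    (by positivity)
    (B := fun ε s => {r | ∀ i ∈ s, t ε < r i}) (fun ε s => measurableSet_forall_mark_lt _ _)
    (fun ε ε' s hε hle r hr i hi => (ht ε ε' hε hle).trans_lt (hr i hi))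
    (fun ε s hε hs => by
      rw [h.measure_forall_mark_lt, hs, mul_comm (m : ℝ), Real.rpow_mul hε.le,
        Real.rpow_natCast, ← mul_pow, ENNReal.ofReal_pow (by positivity)]
      exact pow_le_pow_left' (hp ε hε) m)
    (by linarith)
  filter_upwards [h1] with ω hω
  filter_upwards [(tendsto_order.1 hω).2 1 one_pos] with ε hε c hc s hs
  by_contra! hcard
  obtain ⟨s', hs's, hs'⟩ := Finset.exists_subset_card_eq hcard
  obtain ⟨i, hi⟩ : s'.Nonempty := Finset.card_pos.1 (hs' ▸ hm)
  have hmem : i ∈ grouped (fun i => z i ω) (fun i => ρ i ω) (W / ε) (ε ^ a) m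
      (fun s => {r | ∀ i ∈ s, t ε < r i}) :=
    ⟨s', hi, hs', fun j hj => (hs j (hs's hj)).2, z c ω, hc, fun j hj => (hs j (hs's hj)).1⟩
  have hone : (1 : ℕ∞) ≤ (grouped (fun i => z i ω) (fun i => ρ i ω) (W / ε) (ε ^ a) m
      (fun s => {r | ∀ i ∈ s, t ε < r i})).encard := one_le_encard_iff_nonempty.2 ⟨i, hmem⟩
  have hone' := ENat.toENNReal_le.2 hone
  rw [Real.rpow_zero, ENNReal.ofReal_one, one_mul] at hε
  exact absurd hε (not_lt.2 (by simpa using hone'))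

/-! ### The law of large numbers for the number of points -/

lemma smul_subset_smul_of_starConvex {D : Set (E d)} (hD : StarConvex ℝ 0 D) {s s' : ℝ}
    (hs : 0 < s) (hss' : s ≤ s') : s • D ⊆ s' • D := by
  rintro _ ⟨x, hx, rfl⟩
  have hs' : 0 < s' := hs.trans_le hss'
  refine ⟨(s / s') • x, hD.smul_mem hx (by positivity) ((div_le_one hs').2 hss'), ?_⟩
  simp only [smul_smul]
  rw [mul_div_cancel₀ _ hs'.ne']

/-- Asymptotic density along dilates, from the density along integer dilates of a family of counts
that is monotone in the dilation factor. -/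
lemma tendsto_div_pow_of_nat {n : ℝ → ℝ} {L : ℝ} {d : ℕ}
    (hmono : ∀ s s', 0 < s → s ≤ s' → n s ≤ n s')
    (h : Tendsto (fun k : ℕ => n k / (k : ℝ) ^ d) atTop (𝓝 L)) :
    Tendsto (fun s : ℝ => n s / s ^ d) atTop (𝓝 L) := by
  have hfl : Tendsto (fun s : ℝ => ⌊s⌋₊) atTop atTop := tendsto_nat_floor_atTop
  have hdiv : Tendsto (fun s : ℝ => (⌊s⌋₊ : ℝ) / s) atTop (𝓝 1) := tendsto_nat_floor_div_atTop
  have hdiv' : Tendsto (fun s : ℝ => ((⌊s⌋₊ + 1 : ℕ) : ℝ) / s) atTop (𝓝 1) := by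
    have := hdiv.add tendsto_inv_atTop_zero
    rw [add_zero] at this
    refine this.congr fun s => ?_
    push_cast
    rw [add_div, one_div]
  have hlow := (h.comp hfl).mul (hdiv.pow d)
  have hup := (h.comp ((tendsto_add_atTop_nat 1).comp hfl)).mul (hdiv'.pow d)
  rw [one_pow, mul_one] at hlow hup
  refine tendsto_of_tendsto_of_tendsto_of_le_of_le' hlow hup ?_ ?_
  · filter_upwards [eventually_ge_atTop 1] with s hs
    have hf : 0 < (⌊s⌋₊ : ℝ) := Nat.cast_pos.2 (Nat.floor_pos.2 hs)
    have h1 := hmono _ _ hf (Nat.floor_le (by linarith))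
    simp only [Function.comp]
    rw [div_pow, div_mul_div_cancel₀ (by positivity)]
    gcongr
  · filter_upwards [eventually_ge_atTop 1] with s hs
    have h1 := hmono s _ (by linarith) (Nat.lt_floor_add_one s).le
    simp only [Function.comp]
    rw [div_pow, div_mul_div_cancel₀ (by positivity)]
    push_cast
    gcongr

/-- The number of points in the dilates `k • D`, divided by `k ^ d`, almost surely tends to
`lam * |D|`; as `2 ≤ d` the variances `lam * |D| / k ^ d` are summable. -/
lemma IsMarkedPoisson.ae_tendsto_count_nat (h : IsMarkedPoisson P lam z ρ) (hd : 2 ≤ d)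
    {D : Set (E d)} (hD : MeasurableSet D) (hb : Bornology.IsBounded D) :
    ∀ᵐ ω ∂P, Tendsto (fun k : ℕ => ({i | z i ω ∈ (k : ℝ) • D}.ncard : ℝ) / (k : ℝ) ^ d) atTop
      (𝓝 (lam * (volume D).toReal)) := by
  set v : ℝ := lam * (volume D).toReal with hv
  have hvD : volume D ≠ ∞ := hb.measure_lt_top.ne
  set Y : ℕ → Ω → ℝ≥0∞ := fun k ω => ENNReal.ofReal ((((k : ℝ) + 1) ^ d)⁻¹ ^ 2) *
    ENNReal.ofReal (((({i | z i ω ∈ ((k + 1 : ℕ) : ℝ) • D}.ncard : ℕ) : ℝ) -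
      (lam * (volume (((k + 1 : ℕ) : ℝ) • D)).toNNReal : ℝ≥0)) ^ 2) with hY
  have hmeasD : ∀ k : ℕ, MeasurableSet (((k + 1 : ℕ) : ℝ) • D) := fun k =>
    hD.const_smul₀ _
  have hbD : ∀ k : ℕ, Bornology.IsBounded (((k + 1 : ℕ) : ℝ) • D) := fun k => hb.smul₀ _
  have hvol : ∀ k : ℕ, ((lam * (volume (((k + 1 : ℕ) : ℝ) • D)).toNNReal : ℝ≥0) : ℝ) =
      ((k : ℝ) + 1) ^ d * v := by
    intro k
    rw [Measure.addHaar_smul, finrank_euclideanSpace_fin, ENNReal.toNNReal_mul, hv]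
    push_cast
    rw [abs_of_nonneg (by positivity), ENNReal.toReal_ofReal (by positivity)]
    ring
  have hYmeas : ∀ k, AEMeasurable (Y k) P := by
    intro k
    refine AEMeasurable.const_mul ?_ _
    exact (Measurable.of_discrete (f := fun n : ℕ∞ => ENNReal.ofReal (((n.toNat : ℝ) -
      (lam * (volume (((k + 1 : ℕ) : ℝ) • D)).toNNReal : ℝ≥0)) ^ 2))).comp_aemeasurable
      (h.count_law _ (hmeasD k) (hbD k)).aemeasurable
  have hYint : ∀ k, ∫⁻ ω, Y k ω ∂P ≤ ENNReal.ofReal (v * (((k + 1 : ℕ) : ℝ) ^ d)⁻¹) := by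
    intro k
    rw [hY]
    simp only
    rw [lintegral_const_mul' _ _ ENNReal.ofReal_ne_top]
    have e1 := h.lintegral_count (hmeasD k) (hbD k) (fun n => ENNReal.ofReal (((n.toNat : ℝ) -
      (lam * (volume (((k + 1 : ℕ) : ℝ) • D)).toNNReal : ℝ≥0)) ^ 2))
    have e2 := lintegral_sq_sub_poissonMeasure_le
      (lam * (volume (((k + 1 : ℕ) : ℝ) • D)).toNNReal)
    refine (mul_le_mul_right ((le_of_eq e1).trans e2) _).trans (le_of_eq ?_)
    rw [← ENNReal.ofReal_coe_nnreal, hvol, ← ENNReal.ofReal_mul (by positivity)]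
    congr 1
    push_cast
    field_simp
  have hsum : ∑' k, ∫⁻ ω, Y k ω ∂P ≠ ∞ := by
    refine ne_top_of_le_ne_top ?_ (ENNReal.tsum_le_tsum hYint)
    refine Summable.tsum_ofReal_ne_top (Summable.mul_left v ?_)
    exact (summable_nat_add_iff 1).2 (Real.summable_nat_pow_inv.2 (by omega))
  filter_upwards [ae_tendsto_zero_of_tsum_lintegral hYmeas hsum] with ω hω
  rw [← tendsto_add_atTop_iff_nat 1]
  have h1 := (ENNReal.tendsto_toReal ENNReal.zero_ne_top).comp hω
  have h2 : Tendsto (fun k : ℕ => (({i | z i ω ∈ ((k + 1 : ℕ) : ℝ) • D}.ncard : ℝ) /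
      ((k + 1 : ℕ) : ℝ) ^ d - v) ^ 2) atTop (𝓝 0) := by
    rw [ENNReal.toReal_zero] at h1
    refine h1.congr fun k => ?_
    simp only [Function.comp, hY]
    rw [ENNReal.toReal_mul, ENNReal.toReal_ofReal (by positivity),
      ENNReal.toReal_ofReal (by positivity), hvol, ← mul_pow]
    congr 1
    push_cast
    have : ((k : ℝ) + 1) ≠ 0 := by positivity
    field_simp
  have h3 := h2.sqrt
  simp only [Real.sqrt_sq_eq_abs, Real.sqrt_zero] at h3
  have h4 := (tendsto_zero_iff_abs_tendsto_zero _).2 h3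
  simpa using h4.add_const v

/-- The law of large numbers: the density of the points in `ε⁻¹ • D`. -/
lemma IsMarkedPoisson.ae_tendsto_centres (h : IsMarkedPoisson P lam z ρ) (hd : 2 ≤ d)
    {D : Set (E d)} (hD : IsOpen D) (hb : Bornology.IsBounded D) (hstar : StarConvex ℝ 0 D) :
    ∀ᵐ ω ∂P, (∀ ε, 0 < ε → (centres D (fun i => z i ω) ε).Finite) ∧
      Tendsto (fun ε : ℝ => ENNReal.ofReal (ε ^ d) *
        (((centres D (fun i => z i ω) ε).encard : ℕ∞) : ℝ≥0∞)) (𝓝[>] 0)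
        (𝓝 (lam * volume D)) := by
  have hvD : volume D ≠ ∞ := hb.measure_lt_top.ne
  have hfin : ∀ᵐ ω ∂P, ∀ k : ℕ, {i | z i ω ∈ ((k + 1 : ℕ) : ℝ) • D}.Finite :=
    ae_all_iff.2 fun k => h.ae_finite (hD.measurableSet.const_smul₀ _) (hb.smul₀ _)
  filter_upwards [hfin, h.ae_tendsto_count_nat hd hD.measurableSet hb] with ω hω1 hω2
  have hfin' : ∀ s : ℝ, 0 < s → {i | z i ω ∈ s • D}.Finite := by
    intro s hs
    refine (hω1 ⌊s⌋₊).subset fun i hi => ?_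
    exact smul_subset_smul_of_starConvex hstar hs (by push_cast; exact (Nat.lt_floor_add_one s).le)
      hi
  refine ⟨fun ε hε => hfin' ε⁻¹ (by positivity), ?_⟩
  have h1 := tendsto_div_pow_of_nat (n := fun s => ({i | z i ω ∈ s • D}.ncard : ℝ))
    (fun s s' hs hss' => Nat.cast_le.2 (ncard_le_ncard
      (fun i hi => smul_subset_smul_of_starConvex hstar hs hss' hi)
      (hfin' s' (hs.trans_le hss')))) hω2
  have h2 := ENNReal.tendsto_ofReal (h1.comp tendsto_inv_nhdsGT_zero)
  rw [ENNReal.ofReal_mul lam.coe_nonneg, ENNReal.ofReal_toReal hvD,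
    ENNReal.ofReal_coe_nnreal] at h2
  refine h2.congr' ?_
  filter_upwards [self_mem_nhdsWithin] with ε hε
  have hε' : (0 : ℝ) < ε := hε
  simp only [Function.comp]
  rw [inv_pow, div_inv_eq_mul, mul_comm, ENNReal.ofReal_mul (by positivity),
    ENNReal.ofReal_natCast]
  congr 1
  have := (hfin' ε⁻¹ (by positivity)).cast_ncard_eq
  change ((_ : ℕ) : ℝ≥0∞) = (({i | z i ω ∈ ε⁻¹ • D}.encard : ℕ∞) : ℝ≥0∞)
  rw [← this]
  simp

end AlmostSure

/-! ### Size classes of the holes -/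

/-- The largest rescaled radius of size class `l`. Class `0` consists of the holes that are small
enough to be good; the classes `l + 1` contain the radii between `sizeBound δ ε l` and
`sizeBound δ ε (l + 1)`. -/
def sizeBound (δ ε : ℝ) (l : ℕ) : ℝ := ε ^ (1 - δ * ((l : ℝ) - 2))

/-- The size class of a rescaled radius `R`; the junk value `0` is taken if `R` exceeds
all bounds. -/
def sizeClass (δ ε R : ℝ) : ℕ := sInf {l : ℕ | R ≤ sizeBound δ ε l}

/-- A lower bound for the marks whose rescaled radius belongs to size class `l`; every nonnegative
mark is admitted in class `0`. -/
def threshold (d : ℕ) (δ : ℝ) (l : ℕ) (ε : ℝ) : ℝ :=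
  if l = 0 then -1 else ε ^ (-(2 / ((d : ℝ) - 2) + δ * ((l : ℝ) - 3)))

lemma sizeBound_pos {δ ε : ℝ} (hε : 0 < ε) (l : ℕ) : 0 < sizeBound δ ε l :=
  Real.rpow_pos_of_pos hε _

lemma sizeBound_mono {δ ε : ℝ} (hδ : 0 < δ) (hε : 0 < ε) (hε1 : ε < 1) :
    Monotone (sizeBound δ ε) := by
  intro l l' hll'
  refine Real.rpow_le_rpow_of_exponent_ge hε hε1.le ?_
  have : (l : ℝ) ≤ l' := Nat.cast_le.2 hll'
  nlinarith

lemma le_sizeBound_sizeClass {δ ε R : ℝ} {K : ℕ} (h : R ≤ sizeBound δ ε K) :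
    R ≤ sizeBound δ ε (sizeClass δ ε R) :=
  Nat.sInf_mem (s := {l : ℕ | R ≤ sizeBound δ ε l}) ⟨K, h⟩

lemma sizeClass_le {δ ε R : ℝ} {K : ℕ} (h : R ≤ sizeBound δ ε K) : sizeClass δ ε R ≤ K :=
  Nat.sInf_le h

lemma sizeBound_lt_of_sizeClass_eq {δ ε R : ℝ} {l : ℕ} (h : sizeClass δ ε R = l + 1) :
    sizeBound δ ε l < R := by
  have : l ∉ {l : ℕ | R ≤ sizeBound δ ε l} := Nat.notMem_of_lt_sInf (by
    change l < sizeClass δ ε R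
    omega)
  simpa using this

lemma threshold_lt_of_sizeBound_lt {d : ℕ} (hd : 2 < d) {δ ε ρ : ℝ} (hε : 0 < ε) {l : ℕ}
    (h : sizeBound δ ε l < scaledRadius d ε ρ) : threshold d δ (l + 1) ε < ρ := by
  have hd' : (0 : ℝ) < (d : ℝ) - 2 := by
    have : (2 : ℝ) < d := by exact_mod_cast hd
    linarith
  rw [threshold, if_neg (by omega)]
  have h1 : sizeBound δ ε l = ε ^ ((d : ℝ) / ((d : ℝ) - 2)) *
      ε ^ (-(2 / ((d : ℝ) - 2) + δ * (((l + 1 : ℕ) : ℝ) - 3))) := by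
    rw [sizeBound, ← Real.rpow_add hε]
    congr 1
    push_cast
    field_simp
    ring
  rw [h1, scaledRadius] at h
  exact lt_of_mul_lt_mul_left h (by positivity)

lemma threshold_sizeClass_lt {d : ℕ} (hd : 2 < d) {δ ε ρ : ℝ} (hε : 0 < ε) (hρ : 0 ≤ ρ) :
    threshold d δ (sizeClass δ ε (scaledRadius d ε ρ)) ε < ρ := by
  rcases h : sizeClass δ ε (scaledRadius d ε ρ) with _ | l
  · rw [threshold, if_pos rfl]
    linarith
  · exact threshold_lt_of_sizeBound_lt hd hε (sizeBound_lt_of_sizeClass_eq h)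

lemma scaledRadius_nonneg (d : ℕ) {ε ρ : ℝ} (hε : 0 < ε) (hρ : 0 ≤ ρ) :
    0 ≤ scaledRadius d ε ρ := mul_nonneg (Real.rpow_nonneg hε.le _) hρ

/-- The largest radius of class `l` is smaller by a factor `ε ^ δ` than `ε` times the distance in the
definition of `IsTypical`, so that constant factors can be absorbed. -/
lemma mul_rpow_sizeBound {δ ε : ℝ} (hε : 0 < ε) (l : ℕ) :
    sizeBound δ ε l = ε * ε ^ (-(δ * ((l : ℝ) - 1))) * ε ^ δ := by
  nth_rewrite 2 [← Real.rpow_one ε]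
  rw [sizeBound, ← Real.rpow_add hε, ← Real.rpow_add hε]
  congr 1
  ring

/-! ### The splitting of a typical realisation -/

/-- The properties that almost every realisation of the marked point process has, and from
which the splitting and the covering are constructed. The classes `l = 0, …, K` are the size
classes, and `ε ^ (-(δ * (l - 1)))` is larger than all radii of class `l`, divided by `ε`. -/
structure IsTypical {d : ℕ} (lam : ℝ≥0) (δ : ℝ) (K M : ℕ) (D : Set (E d)) (x : ℕ → E d)
    (r : ℕ → ℝ) : Prop where
  injective : Function.Injective x
  nonneg : ∀ i, 0 ≤ r i
  finite : ∀ ε : ℝ, 0 < ε → (centres D x ε).Finite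
  density : Tendsto (fun ε : ℝ => ENNReal.ofReal (ε ^ d) *
    (((centres D x ε).encard : ℕ∞) : ℝ≥0∞)) (𝓝[>] 0) (𝓝 (lam * volume D))
  close : Tendsto (fun ε : ℝ => ENNReal.ofReal (ε ^ d) *
    (({i ∈ centres D x ε | ∃ j, j ≠ i ∧ dist (x i) (x j) ≤ ε ^ (δ / 4)}.encard : ℕ∞) : ℝ≥0∞))
    (𝓝[>] 0) (𝓝 0)
  near : ∀ l ≤ K, Tendsto (fun ε : ℝ => ENNReal.ofReal (ε ^ d) *
    (({i ∈ centres D x ε | ∃ j, j ≠ i ∧ dist (x i) (x j) ≤ ε ^ (-(δ * ((l : ℝ) - 1))) ∧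
      threshold d δ l ε < r j}.encard : ℕ∞) : ℝ≥0∞)) (𝓝[>] 0) (𝓝 0)
  large : ∀ l ≤ K, Tendsto (fun ε : ℝ => ENNReal.ofReal (ε ^ ((d : ℝ) - d * (δ * ((l : ℝ) - 1)))) *
    (({i ∈ centres D x ε | threshold d δ l ε < r i}.encard : ℕ∞) : ℝ≥0∞)) (𝓝[>] 0) (𝓝 0)
  cluster : ∀ l ≤ K, ∀ᶠ ε : ℝ in 𝓝[>] 0, ∀ c ∈ centres D x ε, ∀ s : Finset ℕ,
    (∀ i ∈ s, dist (x i) (x c) ≤ ε ^ (-(δ * ((l : ℝ) - 1))) ∧ threshold d δ l ε < r i) →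
    s.card ≤ M
  max : ∀ᶠ ε : ℝ in 𝓝[>] 0, ∀ i ∈ centres D x ε, scaledRadius d ε (r i) ≤ ε ^ (2 * (d : ℝ) * δ)

/-- The good centres: those that are isolated, and away from the large holes, even if these are
dilated by `κ`. For `j = i` the second condition says that the hole itself is not large. -/
def goodSet {d : ℕ} (D : Set (E d)) (x : ℕ → E d) (r : ℕ → ℝ) (δ κ ε : ℝ) : Set ℕ :=
  {i ∈ centres D x ε | ∀ j ∈ centres D x ε,
    (j ≠ i → 2 * ε ^ (1 + δ / 2) ≤ ε * dist (x i) (x j)) ∧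
    (ε ^ (1 + 2 * δ) < scaledRadius d ε (r j) →
      κ * scaledRadius d ε (r j) + 2 * ε ^ (1 + δ / 2) ≤ ε * dist (x i) (x j))}

/-- The scale `ε` is small in comparison with the constants `κ` and `L`. -/
structure IsSmallScale (δ κ L ε : ℝ) : Prop where
  pos : 0 < ε
  lt_one : ε < 1
  small : (κ + L + 4) * ε ^ (δ / 4) ≤ 1

lemma eventually_mul_rpow_le {a C c : ℝ} (ha : 0 < a) (hc : 0 < c) :
    ∀ᶠ ε : ℝ in 𝓝[>] 0, C * ε ^ a ≤ c := by
  have h1 : Tendsto (fun ε : ℝ => C * ε ^ a) (𝓝[>] 0) (𝓝 0) := by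
    have h2 : Tendsto (fun ε : ℝ => ε ^ a) (𝓝[>] 0) (𝓝 (0 ^ a)) :=
      ((Real.continuous_rpow_const ha.le).tendsto 0).mono_left nhdsWithin_le_nhds
    rw [Real.zero_rpow ha.ne'] at h2
    simpa using h2.const_mul C
  filter_upwards [(tendsto_order.1 h1).2 c hc] with ε hε using hε.le

lemma eventually_isSmallScale {δ : ℝ} (hδ : 0 < δ) (κ L : ℝ) :
    ∀ᶠ ε : ℝ in 𝓝[>] 0, IsSmallScale δ κ L ε := by
  filter_upwards [Ioo_mem_nhdsGT (zero_lt_one' ℝ),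
    eventually_mul_rpow_le (C := κ + L + 4) (show 0 < δ / 4 by positivity) one_pos]
    with ε h1 h2 using ⟨h1.1, h1.2, h2⟩

lemma IsSmallScale.rpow_le {δ κ L ε a : ℝ} (h : IsSmallScale δ κ L ε) (ha : δ / 4 ≤ a) :
    ε ^ a ≤ ε ^ (δ / 4) :=
  Real.rpow_le_rpow_of_exponent_ge h.pos h.lt_one.le ha

section Typical

variable {d : ℕ} {lam : ℝ≥0} {δ κ L : ℝ} {K M : ℕ} {D : Set (E d)} {x : ℕ → E d} {r : ℕ → ℝ}

lemma dist_smul_centre {ε : ℝ} (hε : 0 < ε) (i j : ℕ) :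
    dist (ε • x i) (ε • x j) = ε * dist (x i) (x j) := by
  rw [dist_smul₀, Real.norm_of_nonneg hε.le]

lemma IsTypical.le_sizeBound (hδ : 0 < δ) (hd : 2 < d) (hK : δ * ((K : ℝ) - 1) = 1) {ε : ℝ}
    (hε : 0 < ε) (hε1 : ε < 1)
    (hmax : ∀ i ∈ centres D x ε, scaledRadius d ε (r i) ≤ ε ^ (2 * (d : ℝ) * δ)) {i : ℕ}
    (hi : i ∈ centres D x ε) : scaledRadius d ε (r i) ≤ sizeBound δ ε K := by
  refine (hmax i hi).trans (Real.rpow_le_rpow_of_exponent_ge hε hε1.le ?_)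
  have : (2 : ℝ) < d := by exact_mod_cast hd
  nlinarith

/-- At small scales any set of holes, in particular the set of the bad ones,
of a typical realisation is classified by size. -/
lemma IsTypical.isClassified (h : IsTypical lam δ K M D x r) (hδ : 0 < δ) (hd : 2 < d)
    (hK : δ * ((K : ℝ) - 1) = 1) (hκ : 0 ≤ κ) {ε : ℝ} (hs : IsSmallScale δ κ L ε)
    (hmax : ∀ i ∈ centres D x ε, scaledRadius d ε (r i) ≤ ε ^ (2 * (d : ℝ) * δ))
    (hclus : ∀ l ≤ K, ∀ c ∈ centres D x ε, ∀ s : Finset ℕ,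
      (∀ i ∈ s, dist (x i) (x c) ≤ ε ^ (-(δ * ((l : ℝ) - 1))) ∧ threshold d δ l ε < r i) →
      s.card ≤ M) {I : Set ℕ} (hI : I ⊆ centres D x ε) :
    IsClassified (fun i => ε • x i) (fun i => scaledRadius d ε (r i))
      (fun i => sizeClass δ ε (scaledRadius d ε (r i))) I (sizeBound δ ε) L M where
  nonneg i _ := scaledRadius_nonneg d hs.pos (h.nonneg i)
  le i hi := le_sizeBound_sizeClass (IsTypical.le_sizeBound hδ hd hK hs.pos hs.lt_one hmax (hI hi))
  lt _ _ _ hl := sizeBound_lt_of_sizeClass_eq hl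
  mono := sizeBound_mono hδ hs.pos hs.lt_one
  pos := sizeBound_pos hs.pos 0
  count l c hc t ht := by
    rcases t.eq_empty_or_nonempty with rfl | ⟨i₀, hi₀⟩
    · simp
    have hl : l ≤ K := by
      rw [← (ht i₀ hi₀).2.1]
      exact sizeClass_le (IsTypical.le_sizeBound hδ hd hK hs.pos hs.lt_one hmax (hI (ht i₀ hi₀).1))
    refine hclus l hl c (hI hc) t fun i hi => ⟨?_, ?_⟩
    · have h1 := (ht i hi).2.2
      rw [dist_smul_centre hs.pos, mul_rpow_sizeBound hs.pos] at h1
      have hp : 0 < ε ^ (-(δ * ((l : ℝ) - 1))) := Real.rpow_pos_of_pos hs.pos _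
      have h2 : L * ε ^ δ ≤ 1 := by
        have h3 := hs.rpow_le (a := δ) (by linarith)
        have h4 : 0 < ε ^ δ := Real.rpow_pos_of_pos hs.pos _
        have h5 := hs.small
        rcases le_total 0 L with hL | hL <;> nlinarith
      have h3 : ε * dist (x i) (x c) ≤ ε * ε ^ (-(δ * ((l : ℝ) - 1))) := by
        refine h1.trans ?_
        have h4 := mul_le_mul_of_nonneg_left h2 (mul_pos hs.pos hp).le
        linarith
      exact le_of_mul_le_mul_left h3 hs.pos
    · rw [← (ht i hi).2.1]
      exact threshold_sizeClass_lt hd hs.pos (h.nonneg i)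

/-- The centres of the holes which are close to some hole of class at least `l`. -/
def nearClass (D : Set (E d)) (x : ℕ → E d) (r : ℕ → ℝ) (δ : ℝ) (l : ℕ) (ε : ℝ) : Set ℕ :=
  {i ∈ centres D x ε | ∃ j ∈ centres D x ε,
    dist (x i) (x j) ≤ ε ^ (-(δ * ((l : ℝ) - 1))) ∧ threshold d δ l ε < r j}

lemma tendsto_encard_union {a : ℝ → ℝ≥0∞} {S T : ℝ → Set ℕ}
    (hS : Tendsto (fun ε => a ε * (((S ε).encard : ℕ∞) : ℝ≥0∞)) (𝓝[>] 0) (𝓝 0))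
    (hT : Tendsto (fun ε => a ε * (((T ε).encard : ℕ∞) : ℝ≥0∞)) (𝓝[>] 0) (𝓝 0)) :
    Tendsto (fun ε => a ε * (((S ε ∪ T ε).encard : ℕ∞) : ℝ≥0∞)) (𝓝[>] 0) (𝓝 0) := by
  have h := hS.add hT
  rw [add_zero] at h
  refine tendsto_of_tendsto_of_tendsto_of_le_of_le tendsto_const_nhds h
    (fun _ => zero_le) fun ε => ?_
  rw [← mul_add, ← ENat.toENNReal_add]
  exact mul_le_mul_right (ENat.toENNReal_le.2 (encard_union_le _ _)) _

lemma tendsto_encard_biUnion {a : ℝ → ℝ≥0∞} {S : ℕ → ℝ → Set ℕ} (K : ℕ)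
    (hS : ∀ l ≤ K, 1 ≤ l →
      Tendsto (fun ε => a ε * (((S l ε).encard : ℕ∞) : ℝ≥0∞)) (𝓝[>] 0) (𝓝 0)) :
    Tendsto (fun ε => a ε * (({i | ∃ l ≤ K, 1 ≤ l ∧ i ∈ S l ε}.encard : ℕ∞) : ℝ≥0∞))
      (𝓝[>] 0) (𝓝 0) := by
  induction K with
  | zero =>
    simp
  | succ K ih =>
    refine tendsto_encard_of_subset (tendsto_encard_union (ih fun l hl => hS l (by omega))
      (hS (K + 1) le_rfl (by omega))) (Eventually.of_forall fun ε i => ?_)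
    rintro ⟨l, h1, h2, h3⟩
    rcases Nat.lt_or_ge l (K + 1) with hl | hl
    · exact Or.inl ⟨l, by omega, h2, h3⟩
    · obtain rfl : l = K + 1 := by omega
      exact Or.inr h3

lemma IsTypical.tendsto_nearClass (h : IsTypical lam δ K M D x r) (hδ : 0 < δ) {l : ℕ}
    (hl : l ≤ K) (hl1 : 1 ≤ l) :
    Tendsto (fun ε : ℝ => ENNReal.ofReal (ε ^ d) *
      (((nearClass D x r δ l ε).encard : ℕ∞) : ℝ≥0∞)) (𝓝[>] 0) (𝓝 0) := by
  have h1 : Tendsto (fun ε : ℝ => ENNReal.ofReal (ε ^ d) *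
      (({i ∈ centres D x ε | threshold d δ l ε < r i}.encard : ℕ∞) : ℝ≥0∞)) (𝓝[>] 0) (𝓝 0) := by
    refine tendsto_of_tendsto_of_tendsto_of_le_of_le' tendsto_const_nhds (h.large l hl)
      (Eventually.of_forall fun _ => zero_le) ?_
    filter_upwards [Ioo_mem_nhdsGT (zero_lt_one' ℝ)] with ε hε
    refine mul_le_mul_left (ENNReal.ofReal_le_ofReal ?_) _
    rw [← Real.rpow_natCast]
    refine Real.rpow_le_rpow_of_exponent_ge hε.1 hε.2.le ?_
    have h2 : (1 : ℝ) ≤ l := by exact_mod_cast hl1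
    have h3 : 0 ≤ (d : ℝ) * (δ * ((l : ℝ) - 1)) :=
      mul_nonneg d.cast_nonneg (mul_nonneg hδ.le (by linarith))
    linarith
  refine tendsto_encard_of_subset (tendsto_encard_union h1 (h.near l hl))
    (Eventually.of_forall fun ε i => ?_)
  rintro ⟨hi, j, hj, hd, ht⟩
  by_cases hji : j = i
  · subst hji
    exact Or.inl ⟨hi, ht⟩
  · exact Or.inr ⟨hi, j, hji, hd, ht⟩

/-- A bad centre is close to another centre or to a large hole. -/
lemma IsTypical.bad_subset (h : IsTypical lam δ K M D x r) (hδ : 0 < δ) (hd : 2 < d)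
    (hK : δ * ((K : ℝ) - 1) = 1) (hκ : 0 ≤ κ) (hL : 0 ≤ L) {ε : ℝ} (hs : IsSmallScale δ κ L ε)
    (hmax : ∀ i ∈ centres D x ε, scaledRadius d ε (r i) ≤ ε ^ (2 * (d : ℝ) * δ)) :
    bad D x (goodSet D x r δ κ) ε ⊆
      {i ∈ centres D x ε | ∃ j, j ≠ i ∧ dist (x i) (x j) ≤ ε ^ (δ / 4)} ∪
      {i | ∃ l ≤ K, 1 ≤ l ∧ i ∈ nearClass D x r δ l ε} := by
  rintro i ⟨hi, hbad⟩
  have hsm := hs.small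
  have hε := hs.pos
  have hq : 0 < ε ^ (δ / 4) := Real.rpow_pos_of_pos hε _
  have hhalf : ε ^ (1 + δ / 2) = ε * (ε ^ (δ / 4) * ε ^ (δ / 4)) := by
    rw [← Real.rpow_add hε, Real.rpow_add hε, Real.rpow_one]
    congr 2
    ring
  have hcon : ∃ j ∈ centres D x ε, (j ≠ i ∧ ε * dist (x i) (x j) < 2 * ε ^ (1 + δ / 2)) ∨
      (ε ^ (1 + 2 * δ) < scaledRadius d ε (r j) ∧
      ε * dist (x i) (x j) < κ * scaledRadius d ε (r j) + 2 * ε ^ (1 + δ / 2)) := by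
    by_contra! hcon
    exact hbad ⟨hi, fun j hj => ⟨(hcon j hj).1, (hcon j hj).2⟩⟩
  obtain ⟨j, hj, ⟨hji, hlt⟩ | ⟨hR, hlt⟩⟩ := hcon
  · left
    refine ⟨hi, j, hji, ?_⟩
    rw [hhalf] at hlt
    refine le_of_mul_le_mul_left (hlt.le.trans ?_) hε
    have : ε ^ (δ / 4) * (2 * ε ^ (δ / 4)) ≤ ε ^ (δ / 4) * 1 :=
      mul_le_mul_of_nonneg_left (by nlinarith) hq.le
    nlinarith
  · right
    set R := scaledRadius d ε (r j) with hRdef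
    have hRK : R ≤ sizeBound δ ε K := IsTypical.le_sizeBound hδ hd hK hε hs.lt_one hmax hj
    have hl0 : sizeClass δ ε R ≠ 0 := by
      intro h0
      have h1 := le_sizeBound_sizeClass hRK
      rw [h0, sizeBound] at h1
      have h2 : 1 - δ * (((0 : ℕ) : ℝ) - 2) = 1 + 2 * δ := by push_cast; ring
      rw [h2] at h1
      linarith
    refine ⟨sizeClass δ ε R, sizeClass_le hRK, Nat.one_le_iff_ne_zero.2 hl0, hi, j, hj, ?_,
      threshold_sizeClass_lt hd hε (h.nonneg j)⟩
    set l := sizeClass δ ε R with hl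
    have h1 : R ≤ sizeBound δ ε l := le_sizeBound_sizeClass hRK
    rw [mul_rpow_sizeBound hε] at h1
    have hl1 : (1 : ℝ) ≤ l := by exact_mod_cast Nat.one_le_iff_ne_zero.2 hl0
    have hp : 1 ≤ ε ^ (-(δ * ((l : ℝ) - 1))) :=
      Real.one_le_rpow_of_pos_of_le_one_of_nonpos hε hs.lt_one.le
        (neg_nonpos.2 (mul_nonneg hδ.le (by linarith)))
    set p := ε ^ (-(δ * ((l : ℝ) - 1))) with hpdef
    have h2 : ε ^ δ ≤ ε ^ (δ / 4) := hs.rpow_le (by linarith)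
    refine le_of_mul_le_mul_left (hlt.le.trans ?_) hε
    have h3 : ε * p * ε ^ δ ≤ ε * p * ε ^ (δ / 4) :=
      mul_le_mul_of_nonneg_left h2 (by positivity)
    have h4 : κ * R ≤ κ * (ε * p * ε ^ (δ / 4)) := mul_le_mul_of_nonneg_left (h1.trans h3) hκ
    have h5 : ε ^ (δ / 4) ≤ 1 := by nlinarith
    have h6 : 2 * ε ^ (1 + δ / 2) ≤ 2 * (ε * p * ε ^ (δ / 4)) := by
      rw [hhalf]
      have : ε * (ε ^ (δ / 4) * ε ^ (δ / 4)) ≤ ε * (p * ε ^ (δ / 4)) := by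
        gcongr
        exact h5.trans hp
      linarith
    have h7 : (κ + 2) * ε ^ (δ / 4) ≤ 1 := by nlinarith
    have h8 := mul_le_mul_of_nonneg_left h7 (show 0 ≤ ε * p by positivity)
    linarith

lemma IsTypical.tendsto_bad (h : IsTypical lam δ K M D x r) (hδ : 0 < δ) (hd : 2 < d)
    (hK : δ * ((K : ℝ) - 1) = 1) (hκ : 0 ≤ κ) :
    Tendsto (fun ε : ℝ => ENNReal.ofReal (ε ^ d) *
      (((bad D x (goodSet D x r δ κ) ε).encard : ℕ∞) : ℝ≥0∞)) (𝓝[>] 0) (𝓝 0) := by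
  refine tendsto_encard_of_subset (tendsto_encard_union h.close
    (tendsto_encard_biUnion K fun l hl hl1 => h.tendsto_nearClass hδ hl hl1)) ?_
  filter_upwards [eventually_isSmallScale hδ κ 0, h.max] with ε hs hmax
  exact h.bad_subset hδ hd hK hκ le_rfl hs hmax

lemma IsTypical.tendsto_good (h : IsTypical lam δ K M D x r) (hδ : 0 < δ) (hd : 2 < d)
    (hK : δ * ((K : ℝ) - 1) = 1) (hκ : 0 ≤ κ) (hvol : volume D ≠ ∞) :
    Tendsto (fun ε : ℝ => ENNReal.ofReal (ε ^ d) *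
      (((goodSet D x r δ κ ε).encard : ℕ∞) : ℝ≥0∞)) (𝓝[>] 0) (𝓝 (lam * volume D)) := by
  have h1 := ENNReal.Tendsto.sub h.density (h.tendsto_bad hδ hd hK hκ)
    (Or.inl (by finiteness))
  rw [tsub_zero] at h1
  refine tendsto_of_tendsto_of_tendsto_of_le_of_le h1 h.density (fun ε => ?_) fun ε => ?_
  · rw [tsub_le_iff_right, ← mul_add, ← ENat.toENNReal_add]
    refine mul_le_mul_right (ENat.toENNReal_le.2 ((encard_le_encard ?_).trans
      (encard_union_le _ _))) _
    intro i hi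
    by_cases hg : i ∈ goodSet D x r δ κ ε
    · exact Or.inl hg
    · exact Or.inr ⟨hi, hg⟩
  · exact mul_le_mul_right (coe_encard_mono fun i hi => hi.1) _

end Typical

/-! ### The dilated bad holes -/

section Splitting

variable {d : ℕ} {lam : ℝ≥0} {δ κ : ℝ} {K M : ℕ} {D : Set (E d)} {x : ℕ → E d} {r : ℕ → ℝ}

/-- The scale `ε` is small, and the bad holes are covered by the holes with index in `J`, all of which
are bad, dilated by factors `g j` not exceeding `κ`. -/
structure IsBadCover (δ κ : ℝ) (D : Set (E d)) (x : ℕ → E d) (r : ℕ → ℝ) (ε : ℝ) (J : Set ℕ)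
    (g : ℕ → ℝ) : Prop where
  scale : IsSmallScale δ κ 0 ε
  max : ∀ i ∈ centres D x ε, scaledRadius d ε (r i) ≤ ε ^ (2 * (d : ℝ) * δ)
  subset : J ⊆ bad D x (goodSet D x r δ κ) ε
  factor_le : ∀ j ∈ J, g j ≤ κ
  covers : ∀ i ∈ bad D x (goodSet D x r δ κ) ε, ∃ j ∈ J,
    dist (ε • x i) (ε • x j) + scaledRadius d ε (r i) ≤ g j * scaledRadius d ε (r j)

lemma IsBadCover.holes_subset {ε : ℝ} {J : Set ℕ} {g : ℕ → ℝ}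
    (h : IsBadCover δ κ D x r ε J g) :
    holes x r ε (bad D x (goodSet D x r δ κ) ε) ⊆ ⋃ j ∈ J, hole x r ε (g j) j := by
  intro a ha
  simp only [holes, mem_iUnion] at ha
  obtain ⟨i, hi, hai⟩ := ha
  obtain ⟨j, hj, hij⟩ := h.covers i hi
  simp only [mem_iUnion]
  refine ⟨j, hj, ?_⟩
  rw [hole, Metric.mem_ball] at hai ⊢
  rw [one_mul] at hai
  linarith [dist_triangle a (ε • x i) (ε • x j)]

lemma goodSet_radius_le {ε : ℝ} (hε : 0 < ε) (hκ : 0 ≤ κ) (hr : ∀ i, 0 ≤ r i) {i : ℕ}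
    (hi : i ∈ goodSet D x r δ κ ε) : scaledRadius d ε (r i) ≤ ε ^ (1 + 2 * δ) := by
  by_contra! hlt
  have h1 := (hi.2 i hi.1).2 hlt
  rw [dist_self, mul_zero] at h1
  have h2 := mul_nonneg hκ (scaledRadius_nonneg d hε (hr i))
  have h3 : 0 < ε ^ (1 + δ / 2) := Real.rpow_pos_of_pos hε _
  linarith

lemma IsSmallScale.radius_le {ε : ℝ} (hδ : 0 < δ) (hκ : 0 ≤ κ) (h : IsSmallScale δ κ 0 ε) :
    (κ + 1) * ε ^ (1 + 2 * δ) ≤ ε ^ (1 + δ / 2) := by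
  have h1 : ε ^ (1 + 2 * δ) = ε ^ (1 + δ / 2) * ε ^ (3 * δ / 2) := by
    rw [← Real.rpow_add h.pos]
    congr 1
    ring
  have h2 := h.rpow_le (a := 3 * δ / 2) (by linarith)
  have h3 : 0 < ε ^ (1 + δ / 2) := Real.rpow_pos_of_pos h.pos _
  have h4 := h.small
  have h5 : 0 < ε ^ (δ / 4) := Real.rpow_pos_of_pos h.pos _
  have h6 : (κ + 1) * ε ^ (3 * δ / 2) ≤ 1 := by nlinarith
  rw [h1]
  nlinarith

/-- The good holes keep a distance from the dilated bad holes. -/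
lemma IsBadCover.le_setDist {ε : ℝ} {J : Set ℕ} {g : ℕ → ℝ} (hδ : 0 < δ) (hκ : 0 ≤ κ)
    (hr : ∀ i, 0 ≤ r i) (h : IsBadCover δ κ D x r ε J g) :
    ENNReal.ofReal (ε ^ (1 + δ / 2)) ≤ setDist (holes x r ε (goodSet D x r δ κ ε))
      (⋃ j ∈ J, hole x r ε (g j) j) := by
  have hε := h.scale.pos
  refine le_iInf₂ fun a ha => Metric.le_infEDist.2 fun b hb => ?_
  simp only [holes, mem_iUnion] at ha hb
  obtain ⟨i, hi, hai⟩ := ha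
  obtain ⟨j, hj, hbj⟩ := hb
  rw [edist_dist]
  refine ENNReal.ofReal_le_ofReal ?_
  rw [hole, Metric.mem_ball] at hai hbj
  rw [one_mul] at hai
  have hjbad := h.subset hj
  have hji : j ≠ i := by
    rintro rfl
    exact hjbad.2 hi
  have h1 := hi.2 j hjbad.1
  have h2 := goodSet_radius_le hε hκ hr hi
  have h3 := h.scale.radius_le hδ hκ
  have hRj := scaledRadius_nonneg d hε (hr j)
  have h4 : g j * scaledRadius d ε (r j) ≤ κ * scaledRadius d ε (r j) :=
    mul_le_mul_of_nonneg_right (h.factor_le j hj) hRj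
  have h5 := dist_triangle4 (ε • x i) a b (ε • x j)
  rw [dist_smul_centre hε, dist_comm (ε • x i) a] at h5
  by_cases hlarge : ε ^ (1 + 2 * δ) < scaledRadius d ε (r j)
  · have h6 := h1.2 hlarge
    have h7 : 0 ≤ κ * ε ^ (1 + 2 * δ) := mul_nonneg hκ (Real.rpow_nonneg hε.le _)
    linarith
  · have h6 := h1.1 hji
    have h7 := mul_le_mul_of_nonneg_left (not_lt.1 hlarge) hκ
    linarith

lemma volume_biUnion_ball_le {S : Set ℕ} {c : ℕ → E d} {ρ : ℕ → ℝ} {R : ℝ} (hR : 0 ≤ R)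
    (hρ : ∀ j ∈ S, ρ j ≤ R) :
    volume (⋃ j ∈ S, Metric.ball (c j) (ρ j)) ≤
      ((S.encard : ℕ∞) : ℝ≥0∞) * (ENNReal.ofReal (R ^ d) * volume (Metric.ball (0 : E d) 1)) := by
  refine (measure_biUnion_le _ S.to_countable _).trans ?_
  calc ∑' j : S, volume (Metric.ball (c j) (ρ j))
      ≤ ∑' _ : S, ENNReal.ofReal (R ^ d) * volume (Metric.ball (0 : E d) 1) := by
        refine ENNReal.tsum_le_tsum fun j => ?_
        refine (measure_mono (Metric.ball_subset_closedBall.trans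
          (Metric.closedBall_subset_closedBall (hρ j j.2)))).trans (le_of_eq ?_)
        rw [Measure.addHaar_closedBall _ _ hR, finrank_euclideanSpace_fin]
    _ = _ := ENNReal.tsum_set_const _ _

/-- The dilated bad holes of all size classes together have small volume. -/
lemma IsBadCover.volume_le {ε : ℝ} {J : Set ℕ} {g : ℕ → ℝ} (hδ : 0 < δ) (hd : 2 < d)
    (hK : δ * ((K : ℝ) - 1) = 1) (hκ : 0 ≤ κ) (hr : ∀ i, 0 ≤ r i)
    (h : IsBadCover δ κ D x r ε J g) :
    volume (⋃ j ∈ J, hole x r ε (g j) j) ≤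
      (ENNReal.ofReal (κ ^ d) * volume (Metric.ball (0 : E d) 1)) *
      ∑ l ∈ Finset.range (K + 1), ENNReal.ofReal (ε ^ ((d : ℝ) - d * (δ * ((l : ℝ) - 1)))) *
        (({i ∈ centres D x ε | threshold d δ l ε < r i}.encard : ℕ∞) : ℝ≥0∞) := by
  have hε := h.scale.pos
  set S : ℕ → Set ℕ := fun l => {j ∈ J | sizeClass δ ε (scaledRadius d ε (r j)) = l} with hS
  have hRK : ∀ j ∈ J, scaledRadius d ε (r j) ≤ sizeBound δ ε K := fun j hj =>
    IsTypical.le_sizeBound hδ hd hK hε h.scale.lt_one h.max (h.subset hj).1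
  have hsub : (⋃ j ∈ J, hole x r ε (g j) j) ⊆
      ⋃ l ∈ Finset.range (K + 1), ⋃ j ∈ S l, hole x r ε (g j) j := by
    intro a ha
    simp only [mem_iUnion] at ha ⊢
    obtain ⟨j, hj, haj⟩ := ha
    exact ⟨_, Finset.mem_range.2 (Nat.lt_succ_iff.2 (sizeClass_le (hRK j hj))), j, ⟨hj, rfl⟩, haj⟩
  refine (measure_mono hsub).trans ((measure_biUnion_finset_le _ _).trans ?_)
  rw [Finset.mul_sum]
  refine Finset.sum_le_sum fun l _ => ?_
  have h1 : volume (⋃ j ∈ S l, hole x r ε (g j) j) ≤ (((S l).encard : ℕ∞) : ℝ≥0∞) *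
      (ENNReal.ofReal ((κ * sizeBound δ ε l) ^ d) * volume (Metric.ball (0 : E d) 1)) := by
    refine volume_biUnion_ball_le (mul_nonneg hκ (sizeBound_pos hε l).le) fun j hj => ?_
    refine mul_le_mul (h.factor_le j hj.1) ?_ (scaledRadius_nonneg d hε (hr j)) hκ
    rw [← hj.2]
    exact le_sizeBound_sizeClass (hRK j hj.1)
  have h2 : (((S l).encard : ℕ∞) : ℝ≥0∞) ≤
      (({i ∈ centres D x ε | threshold d δ l ε < r i}.encard : ℕ∞) : ℝ≥0∞) := by
    refine coe_encard_mono fun j hj => ⟨(h.subset hj.1).1, ?_⟩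
    rw [← hj.2]
    exact threshold_sizeClass_lt hd hε (hr j)
  have h3 : ENNReal.ofReal ((κ * sizeBound δ ε l) ^ d) ≤ ENNReal.ofReal (κ ^ d) *
      ENNReal.ofReal (ε ^ ((d : ℝ) - d * (δ * ((l : ℝ) - 1)))) := by
    rw [← ENNReal.ofReal_mul (by positivity), mul_pow]
    refine ENNReal.ofReal_le_ofReal (mul_le_mul_of_nonneg_left ?_ (by positivity))
    rw [sizeBound, ← Real.rpow_natCast, ← Real.rpow_mul hε.le]
    refine Real.rpow_le_rpow_of_exponent_ge hε h.scale.lt_one.le ?_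
    have : (0 : ℝ) ≤ d := d.cast_nonneg
    nlinarith
  calc _ ≤ _ := h1
    _ ≤ _ := mul_le_mul' h2 (mul_le_mul' h3 le_rfl)
    _ = _ := by ring

/-- A point of the thinned process that is close to a dilated bad hole is the centre of this hole,
or the hole is large. -/
lemma IsBadCover.near_subset {ε η : ℝ} {J : Set ℕ} {g : ℕ → ℝ} (hδ : 0 < δ) (hd : 2 < d)
    (hK : δ * ((K : ℝ) - 1) = 1) (hκ : 0 ≤ κ) (hr : ∀ i, 0 ≤ r i)
    (hx : Function.Injective x) (hη : 0 < η) (hη₁ : κ * ε ^ δ ≤ η / 2)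
    (hη₂ : (2 * η + κ) * ε ^ δ ≤ 1) (h : IsBadCover δ κ D x r ε J g) :
    {i ∈ thinned x (2 * η) ∩ centres D x ε |
      Metric.infEDist (ε • x i) (⋃ j ∈ J, hole x r ε (g j) j) ≤ ENNReal.ofReal (η * ε)} ⊆
    bad D x (goodSet D x r δ κ) ε ∪ {i | ∃ l ≤ K, 1 ≤ l ∧ i ∈ nearClass D x r δ l ε} := by
  rintro i ⟨⟨hthin, hi⟩, hdist⟩
  have hε := h.scale.pos
  have hlt : Metric.infEDist (ε • x i) (⋃ j ∈ J, hole x r ε (g j) j) <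
      ENNReal.ofReal (3 / 2 * η * ε) := by
    refine hdist.trans_lt ((ENNReal.ofReal_lt_ofReal_iff (by positivity)).2 ?_)
    nlinarith [mul_pos hη hε]
  obtain ⟨b, hb, hib⟩ := Metric.infEDist_lt_iff.1 hlt
  rw [edist_dist, ENNReal.ofReal_lt_ofReal_iff (by positivity)] at hib
  simp only [mem_iUnion] at hb
  obtain ⟨j, hj, hbj⟩ := hb
  rw [hole, Metric.mem_ball] at hbj
  set R := scaledRadius d ε (r j) with hRdef
  have hR0 : 0 ≤ R := scaledRadius_nonneg d hε (hr j)
  have hRK : R ≤ sizeBound δ ε K :=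
    IsTypical.le_sizeBound hδ hd hK hε h.scale.lt_one h.max (h.subset hj).1
  have h1 : ε * dist (x i) (x j) < 3 / 2 * η * ε + κ * R := by
    have h2 := dist_triangle (ε • x i) b (ε • x j)
    rw [dist_smul_centre hε] at h2
    have h3 : g j * R ≤ κ * R := mul_le_mul_of_nonneg_right (h.factor_le j hj) hR0
    linarith
  have hRl : R ≤ sizeBound δ ε (sizeClass δ ε R) := le_sizeBound_sizeClass hRK
  -- in the classes `0` and `1` the dilated radius is much smaller than `ε`
  by_cases hl : sizeClass δ ε R ≤ 1
  · left
    have h2 : R ≤ ε * ε ^ δ := by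
      refine hRl.trans ((sizeBound_mono hδ hε h.scale.lt_one hl).trans (le_of_eq ?_))
      rw [mul_rpow_sizeBound hε]
      simp
    have h3 : dist (x i) (x j) < 2 * η := by
      refine lt_of_mul_lt_mul_left (h1.trans_le ?_) hε.le
      have h4 := mul_le_mul_of_nonneg_left h2 hκ
      have h5 := mul_le_mul_of_nonneg_left hη₁ hε.le
      linarith
    have h4 : x j = x i := by
      by_contra hne
      linarith [hthin j hne]
    rw [← hx h4]
    exact h.subset hj
  · right
    push Not at hl
    set l := sizeClass δ ε R with hldef
    refine ⟨l, sizeClass_le hRK, hl.le, hi, j, (h.subset hj).1, ?_,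
      threshold_sizeClass_lt hd hε (hr j)⟩
    rw [mul_rpow_sizeBound hε] at hRl
    have hl2 : (2 : ℝ) ≤ l := by exact_mod_cast hl
    have hp : 1 ≤ ε ^ (-(δ * ((l : ℝ) - 1))) * ε ^ δ := by
      rw [← Real.rpow_add hε]
      refine Real.one_le_rpow_of_pos_of_le_one_of_nonpos hε h.scale.lt_one.le ?_
      nlinarith
    set p := ε ^ (-(δ * ((l : ℝ) - 1))) with hpdef
    have hp0 : 0 < p := Real.rpow_pos_of_pos hε _
    refine le_of_mul_le_mul_left (h1.le.trans ?_) hε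
    have h2 := mul_le_mul_of_nonneg_left hRl hκ
    have h3 := mul_le_mul_of_nonneg_left hη₂ (show 0 ≤ ε * p by positivity)
    have h4 := mul_le_mul_of_nonneg_left hp (show 0 ≤ 2 * η * ε by positivity)
    have h5 : 0 < η * ε := by positivity
    linarith

/-- The dilated bad holes of a typical realisation, covered at all small scales, provide a
splitting. -/
theorem IsTypical.isSplitting (h : IsTypical lam δ K M D x r) (hδ : 0 < δ) (hd : 2 < d)
    (hK : δ * ((K : ℝ) - 1) = 1) (hκ : 0 ≤ κ) (hvol : volume D ≠ ∞) {ε₀ : ℝ} (hε₀ : 0 < ε₀)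
    {J : ℝ → Set ℕ} {g : ℝ → ℕ → ℝ}
    (hJ : ∀ ε ∈ Ioc 0 ε₀, IsBadCover δ κ D x r ε (J ε) (g ε)) :
    IsSplitting lam δ D x r ε₀ (goodSet D x r δ κ)
      (fun ε => ⋃ j ∈ J ε, hole x r ε (g ε j) j) := by
  have hev : ∀ᶠ ε : ℝ in 𝓝[>] 0, ε ∈ Ioc 0 ε₀ := Ioc_mem_nhdsGT hε₀
  have hsafe : ∀ ε ∈ Ioc 0 ε₀, ENNReal.ofReal (ε ^ (1 + δ)) <
      setDist (holes x r ε (goodSet D x r δ κ ε)) (⋃ j ∈ J ε, hole x r ε (g ε j) j) := by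
    intro ε hε
    refine lt_of_lt_of_le ?_ ((hJ ε hε).le_setDist hδ hκ h.nonneg)
    rw [ENNReal.ofReal_lt_ofReal_iff (Real.rpow_pos_of_pos hε.1 _)]
    exact Real.rpow_lt_rpow_of_exponent_gt hε.1 (hJ ε hε).scale.lt_one (by linarith)
  refine ⟨fun ε _ i hi => hi.1, fun ε hε => ?_, fun ε hε => ?_, fun ε hε => (hJ ε hε).holes_subset,
    hsafe, fun ε hε i hi j hj hij => ?_, fun ε hε i hi j hj hij => (hi.2 j hj.1).1 hij.symm,
    fun ε hε i hi => goodSet_radius_le hε.1 hκ h.nonneg hi, ?_,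
    h.tendsto_good hδ hd hK hκ hvol, fun η hη => ?_⟩
  · rw [holes, holes, holes, ← biUnion_union]
    congr 2
    ext a
    have : centres D x ε = goodSet D x r δ κ ε ∪ bad D x (goodSet D x r δ κ) ε := by
      rw [bad, union_sdiff_cancel fun i hi => hi.1]
    rw [← this]
  · rw [Set.disjoint_left]
    intro a ha hb
    have h1 : setDist (holes x r ε (goodSet D x r δ κ ε)) (⋃ j ∈ J ε, hole x r ε (g ε j) j) ≤ 0 :=
      (iInf₂_le a ha).trans (le_of_eq (Metric.infEDist_zero_of_mem ((hJ ε hε).holes_subset hb)))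
    exact absurd (hsafe ε hε) (not_lt.2 (h1.trans zero_le))
  · have h1 := (hi.2 j hj.1).1 hij.symm
    have h2 := goodSet_radius_le hε.1 hκ h.nonneg hi
    have h3 := goodSet_radius_le hε.1 hκ h.nonneg hj
    have h4 := (hJ ε hε).scale.radius_le hδ hκ
    have h5 : 0 ≤ κ * ε ^ (1 + 2 * δ) := mul_nonneg hκ (Real.rpow_nonneg hε.1.le _)
    refine Metric.ball_disjoint_ball ?_
    rw [one_mul, one_mul, dist_smul_centre hε.1]
    linarith
  · have hsum : Tendsto (fun ε : ℝ => (ENNReal.ofReal (κ ^ d) *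
        volume (Metric.ball (0 : E d) 1)) * ∑ l ∈ Finset.range (K + 1),
        ENNReal.ofReal (ε ^ ((d : ℝ) - d * (δ * ((l : ℝ) - 1)))) *
        (({i ∈ centres D x ε | threshold d δ l ε < r i}.encard : ℕ∞) : ℝ≥0∞)) (𝓝[>] 0) (𝓝 0) := by
      have h1 := tendsto_finsetSum (Finset.range (K + 1)) fun l hl =>
        h.large l (Nat.lt_succ_iff.1 (Finset.mem_range.1 hl))
      rw [Finset.sum_const_zero] at h1
      have hv : volume (Metric.ball (0 : E d) 1) ≠ ∞ := measure_ball_lt_top.ne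
      have h2 := ENNReal.Tendsto.const_mul h1
        (Or.inr (show ENNReal.ofReal (κ ^ d) * volume (Metric.ball (0 : E d) 1) ≠ ∞ by finiteness))
      simpa using h2
    refine tendsto_of_tendsto_of_tendsto_of_le_of_le' tendsto_const_nhds hsum
      (Eventually.of_forall fun _ => zero_le) ?_
    filter_upwards [hev] with ε hε using (hJ ε hε).volume_le hδ hd hK hκ h.nonneg
  · refine tendsto_encard_of_subset (tendsto_encard_union (h.tendsto_bad hδ hd hK hκ)
      (tendsto_encard_biUnion K fun l hl hl1 => h.tendsto_nearClass hδ hl hl1)) ?_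
    filter_upwards [hev, eventually_mul_rpow_le (C := κ) hδ (show 0 < η / 2 by positivity),
      eventually_mul_rpow_le (C := 2 * η + κ) hδ one_pos] with ε hε h1 h2
    exact (hJ ε hε).near_subset hδ hd hK hκ h.nonneg h.injective hη h1 h2

/-- A layered covering of the bad holes, with the families renumbered to start with `-3`. -/
lemma IsLayered.isCovering {θ Λ ε : ℝ} {kmax : ℕ} {I : Set ℕ} {If Jf : ℕ → Set ℕ} {f : ℕ → ℝ}
    (hε : 0 < ε) (hΛ : 0 ≤ Λ) (hr : ∀ i, 0 ≤ r i)
    (hmax : ∀ i ∈ I, scaledRadius d ε (r i) ≤ ε ^ (2 * (d : ℝ) * δ))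
    (h : IsLayered (fun i => ε • x i) (fun i => scaledRadius d ε (r i)) θ Λ (kmax + 3) I If Jf f) :
    IsCovering δ kmax θ Λ x r ε I {j | ∃ k ≤ kmax + 3, j ∈ Jf k} (fun k => If (k + 3).toNat)
      (fun k => Jf (k + 3).toNat) f := by
  have hidx : ∀ k ∈ Icc (-3 : ℤ) kmax, (k + 3).toNat ≤ kmax + 3 := by
    intro k hk
    have := hk.1
    have := hk.2
    omega
  have hsubI : ∀ k ≤ kmax + 3, Jf k ⊆ I := fun k hk j hj =>
    (h.mem_iff j).2 ⟨k, hk, h.subset k hk hj⟩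
  have hunion : ∀ (S : ℕ → Set ℕ), {i | ∃ k ≤ kmax + 3, i ∈ S k} =
      ⋃ k ∈ Icc (-3 : ℤ) kmax, S (k + 3).toNat := by
    intro S
    ext i
    simp only [mem_iUnion]
    constructor
    · rintro ⟨k, hk, hik⟩
      refine ⟨(k : ℤ) - 3, ⟨by omega, by omega⟩, ?_⟩
      have : ((k : ℤ) - 3 + 3).toNat = k := by omega
      rwa [this]
    · rintro ⟨k, hk, hik⟩
      exact ⟨_, hidx k hk, hik⟩
  have hdisj : (Icc (-3 : ℤ) kmax).PairwiseDisjoint fun k => If (k + 3).toNat := by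
    intro k hk l hl hkl
    refine Set.disjoint_left.2 fun i hik hil => hkl ?_
    have h1 := h.eq_of_mem _ (hidx k hk) _ (hidx l hl) i hik hil
    have := hk.1
    have := hl.1
    omega
  have hcov : ∀ k ≤ kmax + 3, holes x r ε (If k) ⊆ ⋃ j ∈ Jf k, hole x r ε (f j) j := by
    intro k hk a ha
    simp only [holes, mem_iUnion] at ha ⊢
    obtain ⟨i, hi, hai⟩ := ha
    obtain ⟨j, hj, hij⟩ := h.covers k hk i hi
    refine ⟨j, hj, ?_⟩
    rw [hole, Metric.mem_ball] at hai ⊢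
    rw [one_mul] at hai
    linarith [dist_triangle a (ε • x i) (ε • x j)]
  refine ⟨?_, ?_, ?_, ?_, ?_, hdisj, hunion Jf, ?_, fun k hk => h.subset _ (hidx k hk),
    fun k hk => hcov _ (hidx k hk), ?_, ?_⟩
  · rintro j ⟨k, hk, hj⟩
    exact hsubI k hk hj
  · rintro j ⟨k, hk, hj⟩
    exact ⟨h.one_le k hk j hj, h.le k hk j hj⟩
  · intro a ha
    simp only [holes, mem_iUnion] at ha
    obtain ⟨i, hi, hai⟩ := ha
    obtain ⟨k, hk, hik⟩ := (h.mem_iff i).1 hi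
    have h1 := hcov k hk (mem_iUnion₂.2 ⟨i, hik, hai⟩)
    obtain ⟨j, hj, haj⟩ := mem_iUnion₂.1 h1
    exact mem_iUnion₂.2 ⟨j, ⟨k, hk, hj⟩, haj⟩
  · rintro j ⟨k, hk, hj⟩
    exact mul_le_mul (h.le k hk j hj) (hmax j (hsubI k hk hj)) (scaledRadius_nonneg d hε (hr j)) hΛ
  · rw [← hunion If]
    ext i
    exact h.mem_iff i
  · intro k hk l hl hkl
    exact (hdisj hk hl hkl).mono (h.subset _ (hidx k hk)) (h.subset _ (hidx l hl))
  · intro k hk i hi j hj hij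
    rw [← Set.disjoint_iff_inter_eq_empty]
    refine Metric.ball_disjoint_ball ?_
    have := h.separated _ (hidx k hk) i hi j hj hij
    linarith
  · intro k hk i hi l hl j hj
    rw [← Set.disjoint_iff_inter_eq_empty]
    refine Metric.ball_disjoint_ball ?_
    have h1 := hl.1
    have h2 := hl.2
    have := h.earlier _ (hidx k hk) i hi (l + 3).toNat (by omega) j hj
    linarith

/-- A typical realisation has the splitting and the covering. -/
theorem IsTypical.exists_splitting_covering {θ Λ L : ℝ} {kmax : ℕ} (hδ : 0 < δ) (hd : 2 < d)
    (hK : δ * (((kmax + 3 : ℕ) : ℝ) - 1) = 1) (hθ : 1 < θ) (hΛ : 1 ≤ Λ)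
    (hL : ∀ (y : ℕ → E d) (R : ℕ → ℝ) (cl : ℕ → ℕ) (I : Set ℕ) (s : ℕ → ℝ), I.Finite →
      (∀ i ∈ I, cl i ≤ kmax + 3) → IsClassified y R cl I s L M →
      ∃ (If Jf : ℕ → Set ℕ) (f : ℕ → ℝ), IsLayered y R θ Λ (kmax + 3) I If Jf f)
    (hvol : volume D ≠ ∞) (h : IsTypical lam δ (kmax + 3) M D x r) :
    ∃ ε₀ : ℝ, 0 < ε₀ ∧
      ∃ (n : ℝ → Set ℕ) (J : ℝ → Set ℕ) (If Jf : ℝ → ℤ → Set ℕ) (fac : ℝ → ℕ → ℝ),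
        IsSplitting lam δ D x r ε₀ n (fun ε => ⋃ j ∈ J ε, hole x r ε (θ * fac ε j) j) ∧
        ∀ ε ∈ Ioc 0 ε₀, IsCovering δ kmax θ Λ x r ε (bad D x n ε) (J ε) (If ε) (Jf ε) (fac ε) := by
  have hκ : 0 ≤ θ * Λ := by positivity
  have hclus : ∀ᶠ ε : ℝ in 𝓝[>] 0, ∀ l ≤ kmax + 3, ∀ c ∈ centres D x ε, ∀ s : Finset ℕ,
      (∀ i ∈ s, dist (x i) (x c) ≤ ε ^ (-(δ * ((l : ℝ) - 1))) ∧ threshold d δ l ε < r i) →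
      s.card ≤ M := by
    have h1 := (Filter.eventually_all_finset (Finset.range (kmax + 3 + 1))).2 fun l hl =>
      h.cluster l (Nat.lt_succ_iff.1 (Finset.mem_range.1 hl))
    filter_upwards [h1] with ε hε l hl
    exact hε l (Finset.mem_range.2 (Nat.lt_succ_iff.2 hl))
  have hall := ((eventually_isSmallScale hδ (θ * Λ) L).and
    (eventually_isSmallScale hδ (θ * Λ) 0)).and (h.max.and hclus)
  obtain ⟨ε₀, hε₀, hsub⟩ := mem_nhdsGT_iff_exists_Ioc_subset.1 hall
  have hlay : ∀ ε, ∃ (If Jf : ℕ → Set ℕ) (f : ℕ → ℝ), ε ∈ Ioc 0 ε₀ →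
      IsLayered (fun i => ε • x i) (fun i => scaledRadius d ε (r i)) θ Λ (kmax + 3)
        (bad D x (goodSet D x r δ (θ * Λ)) ε) If Jf f := by
    intro ε
    by_cases hε : ε ∈ Ioc 0 ε₀
    · obtain ⟨⟨hs, _⟩, hmax, hcl⟩ := hsub hε
      have hI : bad D x (goodSet D x r δ (θ * Λ)) ε ⊆ centres D x ε := fun i hi => hi.1
      obtain ⟨If, Jf, f, hf⟩ := hL _ _ _ _ _ ((h.finite ε hε.1).subset hI)
        (fun i hi => sizeClass_le (IsTypical.le_sizeBound hδ hd hK hs.pos hs.lt_one hmax (hI hi)))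
        (h.isClassified hδ hd hK hκ hs hmax hcl hI)
      exact ⟨If, Jf, f, fun _ => hf⟩
    · exact ⟨fun _ => ∅, fun _ => ∅, fun _ => 0, fun h1 => absurd h1 hε⟩
  choose If Jf f hf using hlay
  refine ⟨ε₀, hε₀, goodSet D x r δ (θ * Λ), fun ε => {j | ∃ k ≤ kmax + 3, j ∈ Jf ε k},
    fun ε k => If ε (k + 3).toNat, fun ε k => Jf ε (k + 3).toNat, f, ?_, ?_⟩
  · refine h.isSplitting hδ hd hK hκ hvol hε₀ (g := fun ε j => θ * f ε j) fun ε hε => ?_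
    obtain ⟨⟨_, hs⟩, hmax, _⟩ := hsub hε
    have hl := hf ε hε
    refine ⟨hs, hmax, ?_, ?_, ?_⟩
    · rintro j ⟨k, hk, hj⟩
      exact (hl.mem_iff j).2 ⟨k, hk, hl.subset k hk hj⟩
    · rintro j ⟨k, hk, hj⟩
      exact mul_le_mul_of_nonneg_left (hl.le k hk j hj) (by linarith)
    · intro i hi
      obtain ⟨k, hk, hik⟩ := (hl.mem_iff i).1 hi
      obtain ⟨j, hj, hij⟩ := hl.covers k hk i hik
      refine ⟨j, ⟨k, hk, hj⟩, hij.trans ?_⟩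
      refine mul_le_mul_of_nonneg_right ?_ (scaledRadius_nonneg d hs.pos (h.nonneg j))
      have := hl.one_le k hk j hj
      nlinarith
  · intro ε hε
    obtain ⟨⟨_, hs⟩, hmax, _⟩ := hsub hε
    exact (hf ε hε).isCovering hs.pos (by linarith) h.nonneg fun i hi => hmax i hi.1

end Splitting

/-! ### Almost every realisation is typical -/

section Exponents

/-- The exponent in the bound for the probability that a mark exceeds the threshold of size class
`l`, if the moment of order `q` is finite. -/
def tailExponent (d : ℕ) (δ q : ℝ) (l : ℕ) : ℝ :=
  if l = 0 then 0 else (2 / ((d : ℝ) - 2) + δ * ((l : ℝ) - 3)) * q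

variable {d : ℕ} {δ β : ℝ} {K : ℕ}

lemma classExponent_ge (hd : 2 < d) (hδ : 0 < δ) (h₁ : 2 * δ * ((d : ℝ) - 2) ≤ 1) {l : ℕ}
    (hl : l ≠ 0) :
    1 / ((d : ℝ) - 2) ≤ 2 / ((d : ℝ) - 2) + δ * ((l : ℝ) - 3) := by
  have hd' : (0 : ℝ) < (d : ℝ) - 2 := by
    have : (2 : ℝ) < d := by exact_mod_cast hd
    linarith
  have hl1 : (1 : ℝ) ≤ l := by exact_mod_cast Nat.one_le_iff_ne_zero.2 hl
  have h2 : 2 * δ ≤ 1 / ((d : ℝ) - 2) := (le_div_iff₀ hd').2 h₁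
  have h3 : δ * ((l : ℝ) - 3) ≥ δ * (-2) := mul_le_mul_of_nonneg_left (by linarith) hδ.le
  have h4 : 2 / ((d : ℝ) - 2) = 1 / ((d : ℝ) - 2) + 1 / ((d : ℝ) - 2) := by ring
  linarith

/-- The expected number of points with mark of class at least `l` in a ball whose radius is of the
next larger order decays like a power of `ε`, uniformly in `l`. It is here that the moment of order
larger than `d - 2` is needed. -/
lemma le_tailExponent (hd : 2 < d) (hδ : 0 < δ) (hβ : 0 < β) (hK : δ * ((K : ℝ) - 1) = 1)
    (h₁ : 2 * δ * ((d : ℝ) - 2) ≤ 1) (h₂ : 2 * d * δ ≤ β / (2 * ((d : ℝ) - 2)))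
    {l : ℕ} (hl : l ≤ K) :
    d * δ ≤ d * (-(δ * ((l : ℝ) - 1))) + tailExponent d δ ((d : ℝ) - 2 + β) l := by
  have hd' : (0 : ℝ) < (d : ℝ) - 2 := by
    have : (2 : ℝ) < d := by exact_mod_cast hd
    linarith
  rw [tailExponent]
  split_ifs with h0
  · subst h0
    push_cast
    linarith
  · have hτ := classExponent_ge hd hδ h₁ h0
    set τ := 2 / ((d : ℝ) - 2) + δ * ((l : ℝ) - 3) with hτdef
    have h3 : τ * ((d : ℝ) - 2) = 2 + δ * ((l : ℝ) - 3) * ((d : ℝ) - 2) := by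
      rw [hτdef]
      field_simp
    have h4 : β / ((d : ℝ) - 2) ≤ τ * β := by
      have := mul_le_mul_of_nonneg_right hτ hβ.le
      rwa [one_div_mul_eq_div] at this
    have h5 : β / ((d : ℝ) - 2) = β / (2 * ((d : ℝ) - 2)) + β / (2 * ((d : ℝ) - 2)) := by
      field_simp
      ring
    have h6 : δ * ((l : ℝ) - 1) ≤ 1 := by
      have : (l : ℝ) ≤ K := Nat.cast_le.2 hl
      rw [← hK]
      exact mul_le_mul_of_nonneg_left (by linarith) hδ.le
    have h7 : 0 < δ * ((d : ℝ) - 2) := mul_pos hδ hd'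
    nlinarith

lemma threshold_anti (hd : 2 < d) (hδ : 0 < δ) (h₁ : 2 * δ * ((d : ℝ) - 2) ≤ 1) (l : ℕ) :
    ∀ ε ε', 0 < ε → ε ≤ ε' → threshold d δ l ε' ≤ threshold d δ l ε := by
  intro ε ε' hε hle
  rw [threshold, threshold]
  split_ifs with h0
  · exact le_rfl
  · refine Real.rpow_le_rpow_of_nonpos hε hle (neg_nonpos.2 ?_)
    have hd' : (0 : ℝ) < (d : ℝ) - 2 := by
      have : (2 : ℝ) < d := by exact_mod_cast hd
      linarith
    exact le_trans (by positivity) (classExponent_ge hd hδ h₁ h0)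

end Exponents

section AlmostSure

variable {Ω : Type*} [MeasurableSpace Ω] {P : Measure Ω} {d : ℕ} {lam : ℝ≥0}
  {z : ℕ → Ω → E d} {ρ : ℕ → Ω → ℝ} {δ β : ℝ} {K M : ℕ} {D : Set (E d)}

/-- Markov's inequality. -/
lemma measure_rpow_lt_le [IsProbabilityMeasure P] {X : Ω → ℝ} (hX : ∀ᵐ ω ∂P, 0 ≤ X ω) {q τ ε : ℝ}
    (hq : 0 < q) (hint : Integrable (fun ω => X ω ^ q) P) (hε : 0 < ε) :
    P {ω | ε ^ (-τ) < X ω} ≤ ENNReal.ofReal ((∫ ω, X ω ^ q ∂P + 1) * ε ^ (τ * q)) := by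
  have h1 := mul_meas_ge_le_integral_of_nonneg
    (by filter_upwards [hX] with ω hω using Real.rpow_nonneg hω q) hint (ε ^ (-(τ * q)))
  have h2 : P.real {ω | ε ^ (-(τ * q)) ≤ X ω ^ q} ≤ (∫ ω, X ω ^ q ∂P) * ε ^ (τ * q) := by
    have hpos : 0 < ε ^ (τ * q) := Real.rpow_pos_of_pos hε _
    rw [Real.rpow_neg hε.le] at h1
    rw [inv_mul_le_iff₀ hpos] at h1
    rw [Real.rpow_neg hε.le, mul_comm (∫ ω, X ω ^ q ∂P)]
    exact h1
  have h3 : {ω | ε ^ (-τ) < X ω} ⊆ {ω | ε ^ (-(τ * q)) ≤ X ω ^ q} := by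
    intro ω hω
    have h4 : ε ^ (-(τ * q)) = (ε ^ (-τ)) ^ q := by
      rw [← Real.rpow_mul hε.le, neg_mul]
    rw [mem_ofPred_eq, h4]
    exact Real.rpow_le_rpow (Real.rpow_nonneg hε.le _) (le_of_lt hω) hq.le
  refine (measure_mono h3).trans ?_
  rw [← ofReal_measureReal]
  refine ENNReal.ofReal_le_ofReal (h2.trans ?_)
  refine mul_le_mul_of_nonneg_right (by linarith) (Real.rpow_nonneg hε.le _)

lemma IsMarkedPoisson.measure_threshold_lt_le [IsProbabilityMeasure P]
    (h : IsMarkedPoisson P lam z ρ) {q : ℝ} (hq : 0 < q)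
    (hint : Integrable (fun ω => ρ 0 ω ^ q) P) (l : ℕ) {ε : ℝ} (hε : 0 < ε) :
    P {ω | threshold d δ l ε < ρ 0 ω} ≤
      ENNReal.ofReal ((∫ ω, ρ 0 ω ^ q ∂P + 1) * ε ^ tailExponent d δ q l) := by
  rw [threshold, tailExponent]
  split_ifs with h0
  · refine prob_le_one.trans ?_
    rw [Real.rpow_zero, mul_one, ENNReal.one_le_ofReal]
    have : 0 ≤ ∫ ω, ρ 0 ω ^ q ∂P := integral_nonneg_of_ae (by
      filter_upwards [h.mark_nonneg 0] with ω hω using Real.rpow_nonneg hω q)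
    linarith
  · exact measure_rpow_lt_le (h.mark_nonneg 0) hq hint hε

/-- Almost every realisation of the marked point process is typical. -/
theorem IsMarkedPoisson.ae_isTypical [IsProbabilityMeasure P] (h : IsMarkedPoisson P lam z ρ)
    (hd : 2 < d) (hβ : 0 < β) (hint : Integrable (fun ω => ρ 0 ω ^ ((d : ℝ) - 2 + β)) P)
    (hD : IsOpen D) (hb : Bornology.IsBounded D) (hstar : StarConvex ℝ 0 D)
    (hδ : 0 < δ) (hK : δ * ((K : ℝ) - 1) = 1)
    (h₁ : 2 * δ * ((d : ℝ) - 2) ≤ 1) (h₂ : 2 * d * δ ≤ β / (2 * ((d : ℝ) - 2)))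
    (h₃ : 2 * δ * ((d : ℝ) - 2 + β) < β / ((d : ℝ) - 2))
    (hM : 2 < (M + 1 : ℝ) * δ) :
    ∀ᵐ ω ∂P, IsTypical lam δ K M D (fun i => z i ω) (fun i => ρ i ω) := by
  have hd2 : (2 : ℝ) < d := by exact_mod_cast hd
  have hd' : (0 : ℝ) < (d : ℝ) - 2 := by linarith
  have hq : 0 < (d : ℝ) - 2 + β := by linarith
  obtain ⟨W, hW, hDW⟩ : ∃ W : ℝ, 0 < W ∧ ∀ y ∈ D, ‖y‖ ≤ W := by
    obtain ⟨W, hW⟩ := hb.exists_norm_le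
    exact ⟨max W 1, lt_max_of_lt_right one_pos, fun y hy => (hW y hy).trans (le_max_left _ _)⟩
  have hnorm : ∀ (x : ℕ → E d) (ε : ℝ), 0 < ε → ∀ i ∈ centres D x ε, ‖x i‖ ≤ W / ε := by
    rintro x ε hε i ⟨y, hy, hyx⟩
    simp only at hyx
    rw [← hyx, norm_smul, norm_inv, Real.norm_of_nonneg hε.le, inv_mul_eq_div]
    exact div_le_div_of_nonneg_right (hDW y hy) hε.le
  set C := ∫ ω, ρ 0 ω ^ ((d : ℝ) - 2 + β) ∂P + 1 with hCdef
  have hC : 0 ≤ C := by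
    have : 0 ≤ ∫ ω, ρ 0 ω ^ ((d : ℝ) - 2 + β) ∂P := integral_nonneg_of_ae (by
      filter_upwards [h.mark_nonneg 0] with ω hω using Real.rpow_nonneg hω _)
    linarith
  have hdδ : 0 < d * δ := mul_pos (by linarith) hδ
  have hexp := fun (l : ℕ) (hl : l ≤ K) => le_tailExponent hd hδ hβ hK h₁ h₂ hl
  have ha : ∀ l ≤ K, -1 ≤ -(δ * ((l : ℝ) - 1)) := by
    intro l hl
    have : (l : ℝ) ≤ K := Nat.cast_le.2 hl
    have := mul_le_mul_of_nonneg_left (show (l : ℝ) - 1 ≤ K - 1 by linarith) hδ.le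
    linarith
  have hprob : ∀ l ε, 0 < ε → P {ω | threshold d δ l ε < ρ 0 ω} ≤
      ENNReal.ofReal (C * ε ^ tailExponent d δ ((d : ℝ) - 2 + β) l) := fun l ε hε =>
    h.measure_threshold_lt_le hq hint l hε
  have hanti := fun l => threshold_anti hd hδ h₁ l
  have hnn : ∀ᵐ ω ∂P, ∀ i, 0 ≤ ρ i ω := ae_all_iff.2 h.mark_nonneg
  have hclose := h.ae_tendsto_close (a := δ / 4) (b := 0) (K := 1) hW (by linarith) zero_le_one
    (t := fun _ => -1) (fun _ _ _ _ => le_rfl)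
    (fun ε _ => by simpa using prob_le_one) (by positivity)
  have hnear : ∀ᵐ ω ∂P, ∀ l ≤ K, Tendsto (fun ε : ℝ => ENNReal.ofReal (ε ^ d) *
      (({i | ‖z i ω‖ ≤ W / ε ∧ ∃ j, j ≠ i ∧ dist (z i ω) (z j ω) ≤ ε ^ (-(δ * ((l : ℝ) - 1))) ∧
        threshold d δ l ε < ρ j ω}.encard : ℕ∞) : ℝ≥0∞)) (𝓝[>] 0) (𝓝 0) :=
    ae_all_iff.2 fun l => eventually_imp_distrib_left.2 fun hl =>
      h.ae_tendsto_close hW (ha l hl) hC (hanti l) (hprob l) (by linarith [hexp l hl])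
  have hlarge : ∀ᵐ ω ∂P, ∀ l ≤ K, Tendsto (fun ε : ℝ =>
      ENNReal.ofReal (ε ^ ((d : ℝ) - d * (δ * ((l : ℝ) - 1)))) *
      (({i | ‖z i ω‖ ≤ W / ε ∧ threshold d δ l ε < ρ i ω}.encard : ℕ∞) : ℝ≥0∞))
      (𝓝[>] 0) (𝓝 0) :=
    ae_all_iff.2 fun l => eventually_imp_distrib_left.2 fun hl =>
      h.ae_tendsto_large hW hC (hanti l) (hprob l) (by linarith [hexp l hl])
  have hδ1 : δ ≤ 1 := by
    have : (3 : ℝ) ≤ d := by exact_mod_cast hd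
    nlinarith
  have hcluster : ∀ᵐ ω ∂P, ∀ l ≤ K, ∀ᶠ ε : ℝ in 𝓝[>] 0, ∀ k, ‖z k ω‖ ≤ W / ε →
      ∀ s : Finset ℕ, (∀ i ∈ s, dist (z i ω) (z k ω) ≤ ε ^ (-(δ * ((l : ℝ) - 1))) ∧
        threshold d δ l ε < ρ i ω) → s.card < M + 1 :=
    ae_all_iff.2 fun l => eventually_imp_distrib_left.2 fun hl =>
      h.ae_eventually_card_lt hW (ha l hl) hC (hanti l) (hprob l) (Nat.succ_pos M) (by
        have h4 : -(δ * ((l : ℝ) - 1)) ≤ 1 := by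
          have : (0 : ℝ) ≤ l := l.cast_nonneg
          nlinarith
        have h5 : (d : ℝ) * (-(δ * ((l : ℝ) - 1))) ≤ d * 1 :=
          mul_le_mul_of_nonneg_left h4 (by linarith)
        have h6 := mul_le_mul_of_nonneg_left (hexp l hl) (show (0 : ℝ) ≤ M + 1 by positivity)
        have h7 := mul_lt_mul_of_pos_left hM (show (0 : ℝ) < d by linarith)
        push_cast
        linarith)
  have hτ : 0 ≤ (d : ℝ) / ((d : ℝ) - 2) - 2 * d * δ := by
    have h4 : 2 * d * δ ≤ (d : ℝ) / ((d : ℝ) - 2) := by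
      rw [le_div_iff₀ hd']
      nlinarith
    linarith
  -- with weight `ε ^ 0` the number itself tends to zero, so that there is no such point eventually
  have hmax := h.ae_tendsto_large (e := 0) hW hC
    (t := fun ε => ε ^ (-((d : ℝ) / ((d : ℝ) - 2) - 2 * d * δ)))
    (fun ε ε' hε hle => Real.rpow_le_rpow_of_nonpos hε hle (neg_nonpos.2 hτ))
    (fun ε hε => measure_rpow_lt_le (h.mark_nonneg 0) hq hint hε) (by
      have h4 : (d : ℝ) / ((d : ℝ) - 2) * ((d : ℝ) - 2 + β) = d + d * (β / ((d : ℝ) - 2)) := by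
        field_simp
      have h5 : (d : ℝ) * (2 * δ * ((d : ℝ) - 2 + β)) < d * (β / ((d : ℝ) - 2)) :=
        mul_lt_mul_of_pos_left h₃ (by linarith)
      rw [sub_mul, h4]
      linarith)
  filter_upwards [h.simple, hnn, h.ae_tendsto_centres (by omega) hD hb hstar, hclose, hnear,
    hlarge, hcluster, hmax] with ω hinj hnn hdens hclose hnear hlarge hcluster hmax
  have hn : ∀ ε : ℝ, 0 < ε → ∀ i ∈ centres D (fun i => z i ω) ε, ‖z i ω‖ ≤ W / ε :=
    hnorm fun i => z i ω
  refine ⟨hinj, hnn, hdens.1, hdens.2, ?_, fun l hl => ?_, fun l hl => ?_, fun l hl => ?_, ?_⟩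
  · refine tendsto_encard_of_subset hclose ?_
    filter_upwards [self_mem_nhdsWithin] with ε hε i hi
    obtain ⟨hi, j, hji, hj⟩ := hi
    exact ⟨hn ε hε i hi, j, hji, hj, by linarith [hnn j]⟩
  · refine tendsto_encard_of_subset (hnear l hl) ?_
    filter_upwards [self_mem_nhdsWithin] with ε hε i hi
    exact ⟨hn ε hε i hi.1, hi.2⟩
  · refine tendsto_encard_of_subset (hlarge l hl) ?_
    filter_upwards [self_mem_nhdsWithin] with ε hε i hi
    exact ⟨hn ε hε i hi.1, hi.2⟩
  · filter_upwards [hcluster l hl, self_mem_nhdsWithin] with ε hε hε0 k hk s hs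
    exact Nat.lt_succ_iff.1 (hε k (hn ε hε0 k hk) s hs)
  · filter_upwards [(tendsto_order.1 hmax).2 1 one_pos, self_mem_nhdsWithin] with ε hε hε0 i hi
    have hε0' : (0 : ℝ) < ε := hε0
    by_contra! hlt
    have hmem : i ∈ {i | ‖z i ω‖ ≤ W / ε ∧
        ε ^ (-((d : ℝ) / ((d : ℝ) - 2) - 2 * d * δ)) < ρ i ω} := by
      refine ⟨hn ε hε0' i hi, ?_⟩
      rw [scaledRadius] at hlt
      refine lt_of_mul_lt_mul_left (lt_of_le_of_lt (le_of_eq ?_) hlt)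
        (Real.rpow_nonneg hε0'.le ((d : ℝ) / ((d : ℝ) - 2)))
      rw [← Real.rpow_add hε0']
      congr 1
      ring
    have hone := ENat.toENNReal_le.2 (one_le_encard_iff_nonempty.2 ⟨i, hmem⟩)
    rw [Real.rpow_zero, ENNReal.ofReal_one, one_mul] at hε
    exact absurd hε (not_lt.2 (by simpa using hone))

end AlmostSure

end RandomHoles

end

theorem lemma3p2 (d : ℕ) (hd : 2 < d) (β : ℝ) (hβ : 0 < β) :
    ∃ δ : ℝ, 0 < δ ∧ ∃ kmax : ℕ, 0 < kmax ∧ ∀ θ : ℝ, 1 < θ → ∃ Λ : ℝ, 0 < Λ ∧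
      ∀ (D : Set (RandomHoles.E d)), IsOpen D → Bornology.IsBounded D → StarConvex ℝ 0 D →
      ∀ (Ω : Type*) [MeasurableSpace Ω] (P : Measure Ω) [IsProbabilityMeasure P]
        (lam : ℝ≥0) (z : ℕ → Ω → RandomHoles.E d) (ρ : ℕ → Ω → ℝ),
        0 < lam → RandomHoles.IsMarkedPoisson P lam z ρ →
        Integrable (fun ω => ρ 0 ω ^ ((d : ℝ) - 2 + β)) P →
        ∀ᵐ ω ∂P, ∃ ε₀ : ℝ, 0 < ε₀ ∧
          ∃ (n : ℝ → Set ℕ) (J : ℝ → Set ℕ) (If Jf : ℝ → ℤ → Set ℕ) (fac : ℝ → ℕ → ℝ),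
            RandomHoles.IsSplitting lam δ D (fun i => z i ω) (fun i => ρ i ω) ε₀ n
              (fun ε => ⋃ j ∈ J ε,
                RandomHoles.hole (fun i => z i ω) (fun i => ρ i ω) ε (θ * fac ε j) j) ∧
            ∀ ε ∈ Ioc 0 ε₀,
              RandomHoles.IsCovering δ kmax θ Λ (fun i => z i ω) (fun i => ρ i ω) ε
                (RandomHoles.bad D (fun i => z i ω) n ε) (J ε) (If ε) (Jf ε) (fac ε) := by
  have hd2 : (2 : ℝ) < d := by exact_mod_cast hd
  have hd' : (0 : ℝ) < (d : ℝ) - 2 := by linarith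
  have hq : 0 < (d : ℝ) - 2 + β := by linarith
  obtain ⟨A, hA⟩ := exists_nat_gt (max (2 * ((d : ℝ) - 2))
    (max (2 * d / (β / (2 * ((d : ℝ) - 2)))) (2 * ((d : ℝ) - 2 + β) / (β / ((d : ℝ) - 2)))))
  have hA₁ := (le_max_left _ _).trans_lt hA
  have hA₂ := ((le_max_left _ _).trans (le_max_right _ _)).trans_lt hA
  have hA₃ := ((le_max_right _ _).trans (le_max_right _ _)).trans_lt hA
  -- there are `kmax + 4` size classes, and `1 / δ = kmax + 2`
  set N : ℝ := (A : ℝ) + 3 with hN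
  have hN0 : 0 < N := by positivity
  have hAN : (A : ℝ) < N := by linarith
  set δ : ℝ := 1 / N with hδdef
  have hδ : 0 < δ := by positivity
  have hK : δ * (((A + 1 + 3 : ℕ) : ℝ) - 1) = 1 := by
    have h1 : (((A + 1 + 3 : ℕ) : ℝ) - 1) = N := by
      rw [hN]
      push_cast
      ring
    rw [h1, hδdef, one_div_mul_cancel hN0.ne']
  have h₁ : 2 * δ * ((d : ℝ) - 2) ≤ 1 := by
    rw [hδdef, mul_one_div, div_mul_eq_mul_div, div_le_one hN0]
    linarith
  have h₂ : 2 * d * δ ≤ β / (2 * ((d : ℝ) - 2)) := by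
    rw [hδdef, mul_one_div, div_le_iff₀ hN0, mul_comm (β / _), ← div_le_iff₀ (by positivity)]
    linarith
  have h₃ : 2 * δ * ((d : ℝ) - 2 + β) < β / ((d : ℝ) - 2) := by
    rw [hδdef, mul_one_div, div_mul_eq_mul_div, div_lt_iff₀ hN0, mul_comm (β / _),
      ← div_lt_iff₀ (by positivity)]
    linarith
  obtain ⟨M, hM⟩ := exists_nat_gt (2 / δ)
  have hM' : 2 < (M + 1 : ℝ) * δ := by
    rw [div_lt_iff₀ hδ] at hM
    linarith
  refine ⟨δ, hδ, A + 1, Nat.succ_pos A, fun θ hθ => ?_⟩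
  obtain ⟨Λ, L, hΛ, hL⟩ := RandomHoles.exists_isLayered (RandomHoles.E d) M hθ.le (A + 1 + 3)
  refine ⟨Λ, by linarith, fun D hD hb hstar Ω _ P _ lam z ρ _ h hint => ?_⟩
  filter_upwards [h.ae_isTypical hd hβ hint hD hb hstar hδ hK h₁ h₂ h₃ hM'] with ω hω
  exact hω.exists_splitting_covering hδ hd hK hθ hΛ hL hb.measure_lt_top.ne
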